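/- Let $P(m)=b_dm^d+\dots+b_1m+b_0$ be a polynomial with integer coefficients, of degree $d\ge 1$ and with $b_d>0$. For an integer $t\ge 1$ put $K_t=\frac1t\sum_{m=1}^t 1_{\{P(m)\}}$ on $\mathbb Z$, so that $\widehat{K_t}(\alpha)=\frac1t\sum_{m=1}^t e^{-2\pi i\alpha P(m)}$ for $\alpha\in\mathbb T=\mathbb R/\mathbb Z$. For an integer $n\ge 0$ put $C_t=K_t-K_{2^n}$. For an integer $s\ge 0$ let $\mathcal R_s$ be the set of reduced fractions $a/q$ with $0\le a<q$ and $2^s\le q<2^{s+1}$ (so $\mathcal R_0=\{0/1\}$). With $\{x\}$ the fractional part of $x$, let $D_{a/q}(\alpha)=|\{b_d\alpha\}-a/q|$ if $q\ge 2$; since $0$ and $1$ are identified, let $D_{0/1}(\alpha)$ be the distance from $b_d\alpha$ to the nearest integer. Fix $0<\delta<\frac14$. For $a/q\in\mathcal R_s$ with $s\le n\delta$, the major arc at $a/q$ is $\mathfrak M_n(a/q)=\{\alpha\in\mathbb T: D_{a/q}(\alpha)<2^{-n(d-\delta)}\}$; the set of minor arcs is $\mathfrak m_n=\mathbb T\setminus\bigcup_{s\le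 n\delta}\bigcup_{a/q\in\mathcal R_s}\mathfrak M_n(a/q)$. Then there are an absolute constant $A>0$ and constants $\nu>0$ and $C>0$, depending only on $P$ and $\delta$, such that for all integers $n\ge 0$ and $t$ with $2^n\le t\le 2^{n+1}$: 1. for every $\alpha\in\mathbb T$, $|\widehat{C_t-C_{t+1}}(\alpha)|=|\widehat{K_t-K_{t+1}}(\alpha)|\le A\,2^{-n}$ (in fact $\widehat{C_t-C_{t+1}}(\alpha)=\widehat{K_t-K_{t+1}}(\alpha)$); 2. for every $\alpha\in\mathfrak m_n$, $|\widehat{C_t}(\alpha)|\le C\,2^{-n\nu}$; 3. for every $s\le n\delta$, every $a/q\in\mathcal R_s$ and every $\alpha\in\mathfrak M_n(a/q)$, $$|\widehat{C_t}(\alpha)|\le C\,2^{-\nu s}\Big(\min\Big\{2^nD_{a/q}(\alpha)^{1/d},\ \frac{1}{2^nD_{a/q}(\alpha)^{1/d}}\Big\}+2^{-n/2}\Big),$$ where the minimum is read as $0$ if $D_{a/q}(\alpha)=0$. -/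

import Mathlib

open Polynomial

namespace PolyMeans

noncomputable section

/-- The Fourier transform `∑ x, f x e(-x α)` of a finitely supported function `f` on `ℤ`,
with `e(u) = exp (2 π i u)`. It is `1`-periodic in `α`, so a frequency in `ℝ / ℤ` is
represented here by any of its real representatives. -/
def fourierZ (f : ℤ →₀ ℂ) (α : ℝ) : ℂ :=
  f.sum fun x c => c * Complex.exp (-(2 * Real.pi * Complex.I * (x : ℂ) * (α : ℂ)))

/-- The averaging kernel `K_t = (1 / t) ∑_{m = 1}^{t} 1_{P(m)}` on `ℤ`. -/
def kernelK (P : ℤ[X]) (t : ℕ) : ℤ →₀ ℂ :=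
  (1 / (t : ℂ)) • ∑ m ∈ Finset.Icc 1 t, Finsupp.single (P.eval (m : ℤ)) (1 : ℂ)

/-- The difference `C_t = K_t - K_{2^n}` (used for `t` between `2^n` and `2^{n+1}`). -/
def kernelC (P : ℤ[X]) (n t : ℕ) : ℤ →₀ ℂ :=
  kernelK P t - kernelK P (2 ^ n)

/-- The reduced fractions `a / q` in `ℝ / ℤ` with `2^s ≤ q < 2^{s+1}`, as pairs `(a, q)`
with `0 ≤ a < q`. For `s = 0` the only one is `0 / 1`. -/
def ratShell (s : ℕ) : Set (ℕ × ℕ) :=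
  {r | r.1 < r.2 ∧ Nat.Coprime r.1 r.2 ∧ 2 ^ s ≤ r.2 ∧ r.2 < 2 ^ (s + 1)}

/-- The distance `|{b_d α} - a / q|`, where `b_d` is the leading coefficient of `P`. Since
`0` and `1` are identified, for the fraction `0 / 1` it is the distance from `b_d α` to the
nearest integer. -/
def arcDist (P : ℤ[X]) (a q : ℕ) (α : ℝ) : ℝ :=
  if q = 1 then |(P.leadingCoeff : ℝ) * α - round ((P.leadingCoeff : ℝ) * α)|
  else |Int.fract ((P.leadingCoeff : ℝ) * α) - (a : ℝ) / (q : ℝ)|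

/-- The major arc at scale `n` around `a / q`. -/
def majorArc (P : ℤ[X]) (δ : ℝ) (n a q : ℕ) : Set ℝ :=
  {α | arcDist P a q α < (2 : ℝ) ^ (-((n : ℝ) * ((P.natDegree : ℝ) - δ)))}

/-- The union of the major arcs at scale `n` around all fractions with `q ≈ 2^s`, `s ≤ n δ`. -/
def majorArcs (P : ℤ[X]) (δ : ℝ) (n : ℕ) : Set ℝ :=
  {α | ∃ s : ℕ, (s : ℝ) ≤ (n : ℝ) * δ ∧ ∃ a q : ℕ, (a, q) ∈ ratShell s ∧ α ∈ majorArc P δ n a q}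

/-- The minor arcs at scale `n`. -/
def minorArcs (P : ℤ[X]) (δ : ℝ) (n : ℕ) : Set ℝ :=
  (majorArcs P δ n)ᶜ

end

end PolyMeans

/-!
Let `b` be the leading coefficient and `d` the degree of `P`.

On the minor arcs, Dirichlet's theorem provides an approximation of `b α` whose denominator lies
between `2 ^ (n δ)` and `2 ^ (n (d - δ))`. Weyl differencing turns the exponential sum into an
average of geometric sums over the products `h₁ ⋯ h_{d-1}`; the divisor bound controls the
multiplicity of each product, and the denominator yields the power saving.

On a major arc, `b α` is near `a / q` modulo `1`, so that `α = A / (b q) + γ` with `A ≡ a` modulo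
`q` and `b |γ| = D_{a/q}(α)`. Thus `e(α P(m))` is the product of a factor of period `b q` in `m` and
the slowly varying factor `e(γ P(m))`. Summation by parts replaces the periodic factor by its mean,
a complete exponential sum which saves a power of `q` by Weyl's inequality applied to many
repetitions of the period. Both `K_t` and `K_{2^n}` contain this same factor, so what remains is the
difference of two smooth means. With `y = 2 ^ n |γ| ^ (1 / d)` it is `O(y)` because for `y ≤ 1` both
means are within `O(y)` of `1`, and, up to a lower order term, `O(1 / y)` by the Kusmin–Landau
inequality.
-/

namespace PolyMeans

open scoped FourierTransform

lemma norm_fourierChar_sub_one_le (x : ℝ) : ‖(𝐞 x : ℂ) - 1‖ ≤ 2 * Real.pi * |x| := by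
  rw [Real.fourierChar_apply, mul_comm]
  refine (Real.norm_exp_I_mul_ofReal_sub_one_le (x := 2 * Real.pi * x)).trans_eq ?_
  rw [Real.norm_eq_abs, abs_mul, abs_of_pos Real.two_pi_pos]

lemma norm_fourierChar_sub_le (x y : ℝ) : ‖(𝐞 x : ℂ) - 𝐞 y‖ ≤ 2 * Real.pi * |x - y| := by
  have hfactor : (𝐞 x : ℂ) - 𝐞 y = 𝐞 y * (𝐞 (x - y) - 1) := by
    rw [mul_sub_one, ← Circle.coe_mul, ← AddChar.map_add_eq_mul, add_sub_cancel]
  rw [hfactor, norm_mul, Circle.norm_coe, one_mul]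
  exact norm_fourierChar_sub_one_le _

lemma four_mul_abs_le_norm_fourierChar_sub_one {x : ℝ} (hx : |x| ≤ 1 / 2) :
    4 * |x| ≤ ‖(𝐞 x : ℂ) - 1‖ := by
  have hsin := Real.mul_abs_le_abs_sin (x := Real.pi * x) (by
    rw [abs_mul, abs_of_pos Real.pi_pos]
    nlinarith [Real.pi_pos])
  rw [abs_mul, abs_of_pos Real.pi_pos, ← mul_assoc, div_mul_cancel₀ _ Real.pi_pos.ne'] at hsin
  rw [Real.fourierChar_apply, mul_comm _ Complex.I, Complex.norm_exp_I_mul_ofReal_sub_one,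
    Real.norm_eq_abs, abs_mul, abs_two, show 2 * Real.pi * x / 2 = Real.pi * x by ring]
  linarith

lemma fourierChar_intCast (z : ℤ) : 𝐞 (z : ℝ) = 1 := by
  ext
  rw [Real.fourierChar_apply, Circle.coe_one, Complex.exp_eq_one_iff]
  exact ⟨z, by push_cast; ring⟩

lemma fourierChar_add_intCast (x : ℝ) (z : ℤ) : 𝐞 (x + z) = 𝐞 x := by
  rw [AddChar.map_add_eq_mul, fourierChar_intCast, mul_one]

lemma four_mul_norm_addCircle_le_norm_fourierChar_sub_one (x : ℝ) :
    4 * ‖(x : UnitAddCircle)‖ ≤ ‖(𝐞 x : ℂ) - 1‖ := by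
  rw [UnitAddCircle.norm_eq, ← fourierChar_add_intCast (x) (-round x), Int.cast_neg,
    ← sub_eq_add_neg]
  exact four_mul_abs_le_norm_fourierChar_sub_one (abs_sub_round x)

lemma norm_sum_fourierChar_le (L : ℕ) (f : ℕ → ℝ) :
    ‖∑ m ∈ Finset.range L, (𝐞 (f m) : ℂ)‖ ≤ L :=
  (norm_sum_le_of_le _ fun m _ => (Circle.norm_coe (𝐞 (f m))).le).trans_eq (by simp)

lemma add_one_le_mul_pow {y l : ℝ} (hl : 0 < l) (hy : 1 + l ≤ y) (v : ℕ) :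
    (v : ℝ) + 1 ≤ (1 / l + 1) * y ^ v := by
  have bernoulli : 1 + v * l ≤ y ^ v :=
    (one_add_mul_le_pow (by linarith) v).trans (pow_le_pow_left₀ (by linarith) hy v)
  calc (v : ℝ) + 1 ≤ v + 1 + (1 / l + v * l) := le_add_of_nonneg_right (by positivity)
    _ = (1 / l + 1) * (1 + v * l) := by field_simp; ring
    _ ≤ (1 / l + 1) * y ^ v := by gcongr

lemma rpow_natCast_eq_prod_primeFactors {n : ℕ} (hn : n ≠ 0) (ε : ℝ) :
    (n : ℝ) ^ ε = ∏ p ∈ n.primeFactors, ((p : ℝ) ^ ε) ^ n.factorization p := by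
  conv_lhs => rw [← Nat.prod_factorization_pow_eq_self hn]
  rw [Finsupp.prod, Nat.support_factorization]
  push_cast
  rw [← Real.finsetProd_rpow _ _ (fun i _ => by positivity)]
  exact Finset.prod_congr rfl fun p _ => Real.rpow_pow_comm p.cast_nonneg ε _ |>.symm

lemma exists_card_divisors_le_mul_rpow {ε : ℝ} (hε : 0 < ε) :
    ∃ C : ℝ, 0 < C ∧ ∀ n : ℕ, n ≠ 0 → (n.divisors.card : ℝ) ≤ C * (n : ℝ) ^ ε := by
  set M : ℕ := ⌈(2 : ℝ) ^ (1 / ε)⌉₊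
  set l : ℝ := 2 ^ ε - 1
  have hl : 0 < l := sub_pos.2 (Real.one_lt_rpow one_lt_two hε)
  set B : ℝ := 1 / l + 1
  have hB : 1 ≤ B := le_add_of_nonneg_left (by positivity)
  have exponent_le (p v : ℕ) (hp : 2 ≤ p) :
      (v : ℝ) + 1 ≤ (if p < M then B else 1) * ((p : ℝ) ^ ε) ^ v := by
    split_ifs with hpM
    · refine add_one_le_mul_pow hl ?_ v
      rw [add_sub_cancel]
      exact Real.rpow_le_rpow zero_le_two (by exact_mod_cast hp) hε.le
    · have two_le : (2 : ℝ) ≤ (p : ℝ) ^ ε := by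
        rw [← Real.rpow_inv_le_iff_of_pos zero_le_two p.cast_nonneg hε, ← one_div]
        exact (Nat.le_ceil _).trans (by exact_mod_cast not_lt.1 hpM)
      calc (v : ℝ) + 1 ≤ 2 ^ v := by exact_mod_cast Nat.lt_two_pow_self
        _ ≤ 1 * ((p : ℝ) ^ ε) ^ v := by rw [one_mul]; gcongr
  refine ⟨B ^ M, by positivity, fun n hn => ?_⟩
  calc (n.divisors.card : ℝ) = ∏ p ∈ n.primeFactors, ((n.factorization p : ℝ) + 1) := by
        rw [Nat.card_divisors hn]; push_cast; rfl
    _ ≤ ∏ p ∈ n.primeFactors, (if p < M then B else 1) * ((p : ℝ) ^ ε) ^ n.factorization p :=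
        Finset.prod_le_prod (fun _ _ => by positivity) fun p hp =>
          exponent_le p _ (Nat.prime_of_mem_primeFactors hp).two_le
    _ = B ^ (n.primeFactors.filter (· < M)).card * (n : ℝ) ^ ε := by
        rw [Finset.prod_mul_distrib, ← rpow_natCast_eq_prod_primeFactors hn, Finset.prod_ite,
          Finset.prod_const, Finset.prod_const_one, mul_one]
    _ ≤ B ^ M * (n : ℝ) ^ ε := by
        gcongr
        exact (Finset.card_le_card (t := Finset.range M) fun p hp => by
          simpa using (Finset.mem_filter.1 hp).2).trans_eq (Finset.card_range M)

/-- The function `2 / (1 + N y)` bounds the normalized geometric sum with ratio at distance `y`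
from `1`. It is comparable to `min 1 (1 / (N y))`, and needs no convention at `y = 0`. -/
noncomputable def geomMeanBound (N : ℕ) (y : ℝ) : ℝ := 2 / (1 + N * y)

lemma geomMeanBound_nonneg (N : ℕ) {y : ℝ} (hy : 0 ≤ y) : 0 ≤ geomMeanBound N y := by
  unfold geomMeanBound; positivity

lemma geomMeanBound_anti (N : ℕ) {x y : ℝ} (hx : 0 ≤ x) (hxy : x ≤ y) :
    geomMeanBound N y ≤ geomMeanBound N x := by
  unfold geomMeanBound; gcongr

lemma geomMeanBound_le_two (N : ℕ) {y : ℝ} (hy : 0 ≤ y) : geomMeanBound N y ≤ 2 :=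
  div_le_self zero_le_two (le_add_of_nonneg_right (by positivity))

lemma mul_geomMeanBound_le (N : ℕ) {y : ℝ} (hy : 0 < y) : N * geomMeanBound N y ≤ 2 / y := by
  unfold geomMeanBound
  rw [mul_div_assoc', div_le_div_iff₀ (by positivity) hy]
  linarith

lemma norm_geom_sum_fourierChar_le {L N : ℕ} (hL : L ≤ N) (c θ : ℝ) :
    ‖∑ m ∈ Finset.range L, (𝐞 (c + θ * m) : ℂ)‖ ≤ N * geomMeanBound N ‖(θ : UnitAddCircle)‖ := by
  set S := ∑ m ∈ Finset.range L, (𝐞 (c + θ * m) : ℂ)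
  have trivial_bound : ‖S‖ ≤ N := (norm_sum_fourierChar_le L _).trans (by exact_mod_cast hL)
  have telescope : S * (𝐞 θ - 1) = 𝐞 (c + θ * L) - 𝐞 c := by
    have h := Finset.sum_range_sub (fun m : ℕ => (𝐞 (c + θ * m) : ℂ)) L
    simp only [Nat.cast_zero, mul_zero, add_zero] at h
    rw [← h, Finset.sum_mul]
    refine Finset.sum_congr rfl fun m _ => ?_
    rw [mul_sub_one, ← Circle.coe_mul, ← AddChar.map_add_eq_mul]
    congr 3; push_cast; ring
  have norm_mul_le : ‖S‖ * (4 * ‖(θ : UnitAddCircle)‖) ≤ 2 := calc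
    _ ≤ ‖S‖ * ‖(𝐞 θ : ℂ) - 1‖ := by
      gcongr; exact four_mul_norm_addCircle_le_norm_fourierChar_sub_one θ
    _ = ‖(𝐞 (c + θ * L) : ℂ) - 𝐞 c‖ := by rw [← norm_mul, telescope]
    _ ≤ 1 + 1 := (norm_sub_le _ _).trans_eq (by rw [Circle.norm_coe, Circle.norm_coe])
    _ = 2 := by norm_num
  unfold geomMeanBound
  rw [mul_div_assoc', le_div_iff₀ (by positivity)]
  nlinarith [mul_le_mul_of_nonneg_left norm_mul_le (Nat.cast_nonneg (α := ℝ) N)]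

lemma sum_correlation_succ (a : ℕ → ℂ) (L : ℕ) :
    ∑ h ∈ Finset.range (L + 1), ∑ m ∈ Finset.range (L + 1 - h), a (m + h) * starRingEnd ℂ (a m) =
      (∑ h ∈ Finset.range L, ∑ m ∈ Finset.range (L - h), a (m + h) * starRingEnd ℂ (a m)) +
        a L * starRingEnd ℂ (∑ m ∈ Finset.range (L + 1), a m) := by
  have last_term : ∀ h ∈ Finset.range (L + 1),
      ∑ m ∈ Finset.range (L + 1 - h), a (m + h) * starRingEnd ℂ (a m) =
        (∑ m ∈ Finset.range (L - h), a (m + h) * starRingEnd ℂ (a m)) +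
          a L * starRingEnd ℂ (a (L - h)) := by
    intro h hh
    have hhL : h ≤ L := Nat.lt_succ_iff.1 (Finset.mem_range.1 hh)
    rw [Nat.sub_add_comm hhL, Finset.sum_range_succ, Nat.sub_add_cancel hhL]
  rw [Finset.sum_congr rfl last_term, Finset.sum_add_distrib, Finset.sum_range_succ, Nat.sub_self,
    Finset.range_zero, Finset.sum_empty, add_zero, ← Finset.mul_sum, map_sum,
    ← Finset.sum_range_reflect (fun m => starRingEnd ℂ (a m)) (L + 1)]
  simp only [Nat.add_sub_cancel]

lemma norm_sq_sum_le_re_correlation (a : ℕ → ℂ) (L : ℕ) :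
    ‖∑ m ∈ Finset.range L, a m‖ ^ 2 ≤
      2 * (∑ h ∈ Finset.range L,
        ∑ m ∈ Finset.range (L - h), a (m + h) * starRingEnd ℂ (a m)).re := by
  induction L with
  | zero => simp
  | succ L ih =>
    rw [sum_correlation_succ, Complex.add_re, Finset.sum_range_succ]
    set S := ∑ m ∈ Finset.range L, a m
    have sq_expand : ‖S + a L‖ ^ 2 = ‖S‖ ^ 2 + ‖a L‖ ^ 2 + 2 * (a L * starRingEnd ℂ S).re := by
      rw [Complex.sq_norm, Complex.sq_norm, Complex.sq_norm, Complex.normSq_add]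
      simp only [Complex.mul_re, Complex.conj_re, Complex.conj_im]; ring
    have re_expand : (a L * starRingEnd ℂ (S + a L)).re =
        (a L * starRingEnd ℂ S).re + ‖a L‖ ^ 2 := by
      rw [map_add, mul_add, Complex.add_re, Complex.mul_conj, Complex.sq_norm, Complex.ofReal_re]
    rw [sq_expand, re_expand]
    linarith [sq_nonneg ‖a L‖]

lemma norm_sq_sum_le_sum_norm_correlation (a : ℕ → ℂ) (L : ℕ) :
    ‖∑ m ∈ Finset.range L, a m‖ ^ 2 ≤
      2 * ∑ h ∈ Finset.range L,
        ‖∑ m ∈ Finset.range (L - h), a (m + h) * starRingEnd ℂ (a m)‖ :=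
  (norm_sq_sum_le_re_correlation a L).trans
    (mul_le_mul_of_nonneg_left ((Complex.re_le_norm _).trans (norm_sum_le _ _)) zero_le_two)

lemma coeff_taylor_sub {R : Type*} [CommRing R] {f : R[X]} {j : ℕ} (hf : f.natDegree ≤ j + 1)
    (r : R) : (taylor r f - f).coeff j = (j + 1) * f.coeff (j + 1) * r := by
  have hasseDeriv_eq : hasseDeriv j f = C (f.coeff j) + C ((j + 1) * f.coeff (j + 1)) * X := by
    ext i
    rw [hasseDeriv_coeff]
    match i with
    | 0 => simp
    | 1 => simp [add_comm 1 j, coeff_C]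
    | i + 2 =>
      rw [coeff_eq_zero_of_natDegree_lt (by omega)]
      simp [coeff_one]
  rw [coeff_sub, taylor_coeff, hasseDeriv_eq]
  simp

lemma natDegree_taylor_sub_le {R : Type*} [CommRing R] {f : R[X]} {k : ℕ}
    (hf : f.natDegree ≤ k + 1) (r : R) : (taylor r f - f).natDegree ≤ k := by
  rw [natDegree_le_iff_coeff_eq_zero]
  intro j hj
  rw [coeff_taylor_sub (by omega), coeff_eq_zero_of_natDegree_lt (n := j + 1) (by omega)]
  simp

/-- The mean of `F (h₁ ⋯ h_k)` over `0 ≤ h₁, …, h_k < N`, the average which remains after `k`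
steps of Weyl differencing. -/
noncomputable def productMean (N : ℕ) : ℕ → (ℕ → ℝ) → ℝ
  | 0, F => F 1
  | k + 1, F => (∑ h ∈ Finset.range N, productMean N k fun r => F (h * r)) / N

lemma productMean_nonneg (N k : ℕ) {F : ℕ → ℝ} (hF : ∀ r, 0 ≤ F r) : 0 ≤ productMean N k F := by
  induction k generalizing F with
  | zero => exact hF 1
  | succ k ih => exact div_nonneg (Finset.sum_nonneg fun h _ => ih fun r => hF _) N.cast_nonneg

lemma productMean_const (N k : ℕ) {c : ℝ} (hc : 0 ≤ c) : productMean N k (fun _ => c) ≤ c := by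
  induction k with
  | zero => exact le_rfl
  | succ k ih =>
    unfold productMean
    refine div_le_of_le_mul₀ N.cast_nonneg hc ?_
    refine (Finset.sum_le_card_nsmul _ _ _ fun _ _ => ih).trans_eq ?_
    rw [Finset.card_range, nsmul_eq_mul, mul_comm]

lemma pow_mean_le_mean_pow {ι : Type*} (s : Finset ι) {f : ι → ℝ} (hf : ∀ i ∈ s, 0 ≤ f i) {n : ℕ}
    (hn : n ≠ 0) : ((∑ i ∈ s, f i) / s.card) ^ n ≤ (∑ i ∈ s, f i ^ n) / s.card := by
  obtain ⟨p, rfl⟩ := Nat.exists_eq_succ_of_ne_zero hn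
  rcases s.eq_empty_or_nonempty with rfl | hs
  · simp
  have hcard : (0 : ℝ) < s.card := by exact_mod_cast hs.card_pos
  rw [div_pow, div_le_div_iff₀ (by positivity) hcard, pow_succ (s.card : ℝ),
    ← mul_assoc, mul_comm _ ((s.card : ℝ) ^ p)]
  gcongr
  exact pow_sum_le_card_mul_sum_pow hf p

lemma norm_sq_sum_fourierChar_eval_le (f : ℝ[X]) {L N : ℕ} (hL : L ≤ N) :
    ‖∑ m ∈ Finset.range L, (𝐞 (f.eval (m : ℝ)) : ℂ)‖ ^ 2 ≤
      2 * ∑ h ∈ Finset.range N,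
        ‖∑ m ∈ Finset.range (L - h), (𝐞 ((taylor (h : ℝ) f - f).eval (m : ℝ)) : ℂ)‖ := by
  refine (norm_sq_sum_le_sum_norm_correlation _ L).trans ?_
  have correlation_eq (h m : ℕ) : (𝐞 (f.eval ((m + h : ℕ) : ℝ)) : ℂ) *
      starRingEnd ℂ (𝐞 (f.eval (m : ℝ))) = 𝐞 ((taylor (h : ℝ) f - f).eval (m : ℝ)) := by
    rw [← Circle.coe_inv_eq_conj, ← AddChar.map_neg_eq_inv, ← Circle.coe_mul,
      ← AddChar.map_add_eq_mul, eval_sub, taylor_eval, ← sub_eq_add_neg, Nat.cast_add]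
  simp only [correlation_eq]
  gcongr

lemma pow_norm_sum_fourierChar_eval_le_mean (f : ℝ[X]) {L N : ℕ} (hL : L ≤ N) (k : ℕ) :
    (‖∑ m ∈ Finset.range L, (𝐞 (f.eval (m : ℝ)) : ℂ)‖ / N) ^ 2 ^ (k + 1) ≤
      2 ^ 2 ^ k * ((∑ h ∈ Finset.range N, (‖∑ m ∈ Finset.range (L - h),
        (𝐞 ((taylor (h : ℝ) f - f).eval (m : ℝ)) : ℂ)‖ / N) ^ 2 ^ k) / N) := by
  set S := ∑ m ∈ Finset.range L, (𝐞 (f.eval (m : ℝ)) : ℂ)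
  set T : ℕ → ℂ := fun h => ∑ m ∈ Finset.range (L - h),
    (𝐞 ((taylor (h : ℝ) f - f).eval (m : ℝ)) : ℂ)
  have norm_sq_le : (‖S‖ / N) ^ 2 ≤ 2 * ((∑ h ∈ Finset.range N, ‖T h‖ / N) / N) := by
    rw [← Finset.sum_div, div_div, ← sq, div_pow, mul_div_assoc']
    gcongr
    exact norm_sq_sum_fourierChar_eval_le f hL
  have jensen := pow_mean_le_mean_pow (Finset.range N) (f := fun h => ‖T h‖ / N)
    (fun _ _ => by positivity) (n := 2 ^ k) (by positivity)
  rw [Finset.card_range] at jensen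
  calc (‖S‖ / N) ^ 2 ^ (k + 1)
      = ((‖S‖ / N) ^ 2) ^ 2 ^ k := by rw [← pow_mul, ← pow_succ']
    _ ≤ (2 * ((∑ h ∈ Finset.range N, ‖T h‖ / N) / N)) ^ 2 ^ k := by gcongr
    _ = 2 ^ 2 ^ k * ((∑ h ∈ Finset.range N, ‖T h‖ / N) / N) ^ 2 ^ k := mul_pow ..
    _ ≤ 2 ^ 2 ^ k * ((∑ h ∈ Finset.range N, (‖T h‖ / N) ^ 2 ^ k) / N) := by gcongr

lemma pow_norm_sum_fourierChar_eval_le (N k : ℕ) {f : ℝ[X]} (hf : f.natDegree ≤ k + 1) {L : ℕ}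
    (hL : L ≤ N) :
    (‖∑ m ∈ Finset.range L, (𝐞 (f.eval (m : ℝ)) : ℂ)‖ / N) ^ 2 ^ k ≤
      2 ^ 2 ^ k * productMean N k fun r =>
        geomMeanBound N ‖(((k + 1).factorial * f.coeff (k + 1) * r : ℝ) : UnitAddCircle)‖ := by
  induction k generalizing f L with
  | zero =>
    have eval_eq (m : ℕ) : f.eval (m : ℝ) = f.coeff 0 + f.coeff 1 * m := by
      conv_lhs => rw [eq_X_add_C_of_natDegree_le_one hf]
      simp [add_comm]
    simp only [eval_eq, productMean, pow_zero, pow_one, zero_add, Nat.factorial_one, Nat.cast_one,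
      one_mul, mul_one]
    have nonneg := geomMeanBound_nonneg N (norm_nonneg (f.coeff 1 : UnitAddCircle))
    refine (div_le_of_le_mul₀ N.cast_nonneg nonneg ?_).trans
      (le_mul_of_one_le_left nonneg one_le_two)
    rw [mul_comm]
    exact norm_geom_sum_fourierChar_le hL _ _
  | succ k ih =>
    set F : ℕ → ℝ := fun r => geomMeanBound N
      ‖(((k + 1 + 1).factorial * f.coeff (k + 1 + 1) * r : ℝ) : UnitAddCircle)‖
    have inner_le (h : ℕ) : (‖∑ m ∈ Finset.range (L - h),
        (𝐞 ((taylor (h : ℝ) f - f).eval (m : ℝ)) : ℂ)‖ / N) ^ 2 ^ k ≤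
          2 ^ 2 ^ k * productMean N k fun r => F (h * r) := by
      refine (ih (natDegree_taylor_sub_le hf h) ((L.sub_le h).trans hL)).trans_eq ?_
      simp only [F, coeff_taylor_sub hf, Nat.factorial_succ (k + 1)]
      push_cast
      ring_nf
    calc _ ≤ _ := pow_norm_sum_fourierChar_eval_le_mean f hL k
      _ ≤ 2 ^ 2 ^ k *
          ((∑ h ∈ Finset.range N, 2 ^ 2 ^ k * productMean N k fun r => F (h * r)) / N) := by
        gcongr
        exact inner_le _
      _ = 2 ^ 2 ^ (k + 1) * productMean N (k + 1) F := by
        rw [productMean, ← Finset.mul_sum, pow_succ 2 k, pow_mul]; ring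

lemma sum_sum_mul_le_sum_card_divisors (A B : ℕ) {G : ℕ → ℝ} (hG : ∀ r, 0 ≤ G r) :
    ∑ h ∈ Finset.Icc 1 A, ∑ r ∈ Finset.Icc 1 B, G (h * r) ≤
      ∑ r ∈ Finset.Icc 1 (A * B), r.divisors.card * G r := by
  set s := Finset.Icc 1 A ×ˢ Finset.Icc 1 B
  have maps_to : ∀ p ∈ s, p.1 * p.2 ∈ Finset.Icc 1 (A * B) := by
    intro p hp
    simp only [s, Finset.mem_product, Finset.mem_Icc] at hp ⊢
    exact ⟨Nat.mul_pos hp.1.1 hp.2.1, Nat.mul_le_mul hp.1.2 hp.2.2⟩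
  have card_fiber_le (r : ℕ) (hr : r ∈ Finset.Icc 1 (A * B)) :
      (s.filter fun p => p.1 * p.2 = r).card ≤ r.divisors.card := by
    have hr0 : r ≠ 0 := Nat.one_le_iff_ne_zero.1 (Finset.mem_Icc.1 hr).1
    refine Finset.card_le_card_of_injOn Prod.fst
      (fun p hp => Nat.mem_divisors.2 ⟨⟨p.2, (Finset.mem_filter.1 hp).2.symm⟩, hr0⟩) ?_
    intro p hp p' hp' hfst
    obtain ⟨-, hp⟩ := Finset.mem_filter.1 hp
    obtain ⟨-, hp'⟩ := Finset.mem_filter.1 hp'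
    have hpos : 0 < p.1 := Nat.pos_of_ne_zero fun h0 => hr0 (by rw [← hp, h0, zero_mul])
    exact Prod.ext hfst (Nat.eq_of_mul_eq_mul_left hpos (by rw [hp, hfst, hp']))
  rw [← Finset.sum_product', ← Finset.sum_fiberwise_of_maps_to maps_to]
  refine Finset.sum_le_sum fun r hr => ?_
  rw [Finset.sum_congr rfl fun p hp => by rw [(Finset.mem_filter.1 hp).2], Finset.sum_const,
    nsmul_eq_mul]
  exact mul_le_mul_of_nonneg_right (by exact_mod_cast card_fiber_le r hr) (hG r)

lemma sum_sum_card_divisors_pow_mul_le (N k : ℕ) {F : ℕ → ℝ} (hF : ∀ r, 0 ≤ F r) :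
    ∑ h ∈ Finset.Icc 1 N, ∑ r ∈ Finset.Icc 1 (N ^ k), (r.divisors.card : ℝ) ^ k * F (h * r) ≤
      ∑ r ∈ Finset.Icc 1 (N ^ (k + 1)), (r.divisors.card : ℝ) ^ (k + 1) * F r := by
  have grouped := sum_sum_mul_le_sum_card_divisors N (N ^ k)
    (G := fun r => (r.divisors.card : ℝ) ^ k * F r) fun r => mul_nonneg (by positivity) (hF r)
  refine (Finset.sum_le_sum fun h hh => Finset.sum_le_sum fun r hr => ?_).trans
    (grouped.trans_eq ?_)
  · have hhr : h * r ≠ 0 := mul_ne_zero (Nat.one_le_iff_ne_zero.1 (Finset.mem_Icc.1 hh).1)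
      (Nat.one_le_iff_ne_zero.1 (Finset.mem_Icc.1 hr).1)
    have := hF (h * r)
    gcongr
    exact dvd_mul_left r h
  · rw [pow_succ' N]
    exact Finset.sum_congr rfl fun r _ => by rw [pow_succ', mul_assoc]

lemma productMean_le (N k : ℕ) {F : ℕ → ℝ} (hF : ∀ r, 0 ≤ F r) :
    productMean N k F ≤ k / N * F 0 +
      (∑ r ∈ Finset.Icc 1 (N ^ k), (r.divisors.card : ℝ) ^ k * F r) / N ^ k := by
  induction k generalizing F with
  | zero => simp [productMean]
  | succ k ih =>
    have hF0 := hF 0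
    have zero_term : productMean N k (fun r => F (0 * r)) ≤ F 0 := by
      simpa only [zero_mul] using productMean_const N k hF0
    have pos_terms : ∑ h ∈ Finset.Icc 1 N, productMean N k (fun r => F (h * r)) ≤
        N * (k / N * F 0) +
          (∑ r ∈ Finset.Icc 1 (N ^ (k + 1)), (r.divisors.card : ℝ) ^ (k + 1) * F r) / N ^ k := by
      refine (Finset.sum_le_sum fun h _ => ih (F := fun r => F (h * r)) fun r => hF _).trans ?_
      simp only [mul_zero]
      rw [Finset.sum_add_distrib, Finset.sum_const, Nat.card_Icc, nsmul_eq_mul,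
        Nat.add_sub_cancel, ← Finset.sum_div]
      gcongr
      exact sum_sum_card_divisors_pow_mul_le N k hF
    rcases N.eq_zero_or_pos with rfl | hN
    · simp [productMean]
    have hN' : (0 : ℝ) < N := by exact_mod_cast hN
    have range_subset : Finset.range N ⊆ insert 0 (Finset.Icc 1 N) := by
      intro h
      simp only [Finset.mem_range, Finset.mem_insert, Finset.mem_Icc]
      omega
    rw [productMean, div_le_iff₀ hN']
    calc ∑ h ∈ Finset.range N, productMean N k (fun r => F (h * r))
        ≤ ∑ h ∈ insert 0 (Finset.Icc 1 N), productMean N k (fun r => F (h * r)) :=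
          Finset.sum_le_sum_of_subset_of_nonneg range_subset fun h _ _ =>
            productMean_nonneg N k fun r => hF _
      _ ≤ F 0 + _ := by
          rw [Finset.sum_insert (by simp)]
          exact add_le_add zero_term pos_terms
      _ = _ := by push_cast; field_simp; ring

lemma min_le_norm_unitAddCircle (x : ℝ) : min x (1 - x) ≤ ‖(x : UnitAddCircle)‖ := by
  rw [UnitAddCircle.norm_eq]
  rcases le_or_gt (round x) 0 with h | h
  · have hz : (round x : ℝ) ≤ 0 := by exact_mod_cast h
    exact (min_le_left _ _).trans ((by linarith : x ≤ x - round x).trans (le_abs_self _))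
  · have hz : (1 : ℝ) ≤ round x := by exact_mod_cast h
    exact (min_le_right _ _).trans
      ((by linarith : 1 - x ≤ -(x - round x)).trans (neg_le_abs _))

lemma sum_range_val_mul_add {M : Type*} [AddCommMonoid M] {q : ℕ} [NeZero q] {a : ZMod q}
    (ha : IsUnit a) (b : ZMod q) (F : ℕ → M) :
    ∑ u ∈ Finset.range q, F (a * u + b).val = ∑ v ∈ Finset.range q, F v := by
  have sum_val (G : ℕ → M) : ∑ x : ZMod q, G x.val = ∑ v ∈ Finset.range q, G v := by
    obtain ⟨p, rfl⟩ := Nat.exists_eq_succ_of_ne_zero (NeZero.ne q)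
    exact Fin.sum_univ_eq_sum_range G (p + 1)
  rw [← sum_val F, ← sum_val fun u => F (a * u + b).val]
  simp only [ZMod.natCast_zmod_val]
  exact ((ha.unit.mulLeft).trans (Equiv.addRight b)).sum_comp fun x => F x.val

lemma natCast_mul_sum_geomMeanBound_le (N : ℕ) {q : ℕ} (hq : 1 ≤ q) :
    N * ∑ v ∈ Finset.range q, geomMeanBound N (((v - 1 : ℕ) : ℝ) / q) ≤
      4 * N + 2 * q * (1 + Real.log q) := by
  have hq' : (0 : ℝ) < q := by exact_mod_cast hq
  set G : ℕ → ℝ := fun v => N * geomMeanBound N ((v : ℝ) / q)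
  have hG_nonneg (v : ℕ) : 0 ≤ G v :=
    mul_nonneg N.cast_nonneg (geomMeanBound_nonneg N (by positivity))
  have G_zero_le : G 0 ≤ 2 * N := by
    have h := geomMeanBound_le_two N (y := ((0 : ℕ) : ℝ) / q) (by positivity)
    calc G 0 ≤ N * 2 := mul_le_mul_of_nonneg_left h N.cast_nonneg
      _ = 2 * N := mul_comm _ _
  have G_succ_le (v : ℕ) : G (v + 1) ≤ 2 * q * ((v + 1 : ℕ) : ℝ)⁻¹ := by
    refine (mul_geomMeanBound_le N (by positivity)).trans_eq ?_
    rw [div_div_eq_mul_div, div_eq_mul_inv]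
  have shift_le :
      ∑ v ∈ Finset.range q, G (v - 1) ≤ ∑ v ∈ Finset.range q, G (v + 1) + 2 * G 0 := by
    obtain ⟨p, rfl⟩ := Nat.exists_eq_add_of_le' hq
    rw [Finset.sum_range_succ', Finset.sum_range_succ]
    have h := Finset.sum_range_succ' G p
    rw [Finset.sum_range_succ] at h
    simp only [Nat.add_sub_cancel, Nat.zero_sub]
    linarith [hG_nonneg p, hG_nonneg (p + 1)]
  have harmonic_le : (harmonic q : ℝ) ≤ 1 + Real.log q := harmonic_le_one_add_log q
  calc N * ∑ v ∈ Finset.range q, geomMeanBound N (((v - 1 : ℕ) : ℝ) / q)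
      = ∑ v ∈ Finset.range q, G (v - 1) := Finset.mul_sum ..
    _ ≤ ∑ v ∈ Finset.range q, 2 * q * ((v + 1 : ℕ) : ℝ)⁻¹ + 2 * (2 * N) :=
      shift_le.trans (add_le_add (Finset.sum_le_sum fun v _ => G_succ_le v) (by linarith))
    _ = 4 * N + 2 * q * harmonic q := by
      rw [← Finset.mul_sum, harmonic]; push_cast; ring
    _ ≤ 4 * N + 2 * q * (1 + Real.log q) := by gcongr

lemma exists_mul_add_eq_val_add_div {α : ℝ} {a : ℤ} {q : ℕ} (hq : 1 ≤ q)
    (hα : |α - a / q| ≤ 1 / (q : ℝ) ^ 2) (r₀ : ℕ) :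
    ∃ b : ZMod q, ∀ u < q, ∃ z : ℤ, ∃ ψ : ℝ, -1 ≤ ψ ∧ ψ ≤ 2 ∧
      α * (r₀ + u : ℕ) = (((a : ZMod q) * u + b).val + ψ) / q + z := by
  have : NeZero q := ⟨by omega⟩
  refine ⟨(⌊q * (α * r₀)⌋ : ℤ), fun u hu => ?_⟩
  set b := ⌊q * (α * r₀)⌋
  set θ := Int.fract (q * (α * r₀))
  have hbθ : (b : ℝ) + θ = q * (α * r₀) := Int.floor_add_fract _
  have drift : |q * (α - a / q) * u| ≤ 1 := calc
    _ = q * |α - a / q| * u := by rw [abs_mul, abs_mul, Nat.abs_cast, Nat.abs_cast]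
    _ ≤ q * (1 / (q : ℝ) ^ 2) * q := by gcongr
    _ = 1 := by field_simp
  have val_eq : ((((a : ZMod q) * u + b).val : ℤ)) = (a * u + b) % q := by
    rw [← ZMod.val_intCast]; push_cast; rfl
  have div_mod : (a * u + b : ℝ) =
      (((a : ZMod q) * u + b).val : ℝ) + q * (((a * u + b) / q : ℤ) : ℝ) := by
    have h := Int.emod_add_mul_ediv (a * u + b) q
    rw [← val_eq] at h
    exact_mod_cast h.symm
  refine ⟨(a * u + b) / q, θ + q * (α - a / q) * u, ?_, ?_, ?_⟩
  · linarith [Int.fract_nonneg (q * (α * r₀)), (abs_le.1 drift).1]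
  · linarith [Int.fract_lt_one (q * (α * r₀)), (abs_le.1 drift).2]
  · field_simp
    push_cast
    linear_combination div_mod - hbθ

lemma geomMeanBound_norm_le (N : ℕ) {q w : ℕ} (hw : w < q) {x ψ : ℝ} (hψ₁ : -1 ≤ ψ) (hψ₂ : ψ ≤ 2)
    {z : ℤ} (hx : x = (w + ψ) / q + z) :
    geomMeanBound N ‖(x : UnitAddCircle)‖ ≤ geomMeanBound N (((w - 1 : ℕ) : ℝ) / q) +
      geomMeanBound N (((q - 1 - w - 1 : ℕ) : ℝ) / q) := by
  have hq' : (0 : ℝ) < q := by exact_mod_cast (Nat.zero_le w).trans_lt hw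
  set y : ℝ := (w + ψ) / q
  have norm_eq : ‖(x : UnitAddCircle)‖ = ‖(y : UnitAddCircle)‖ := by
    rw [hx, UnitAddCircle.norm_eq, UnitAddCircle.norm_eq, round_add_intCast]
    congr 1; push_cast; ring
  have g_nonneg (k : ℕ) : 0 ≤ geomMeanBound N ((k : ℝ) / q) :=
    geomMeanBound_nonneg N (by positivity)
  have left_le : ((w - 1 : ℕ) : ℝ) / q ≤ max 0 y := by
    rcases w.eq_zero_or_pos with rfl | h
    · simp
    · refine le_max_of_le_right ?_
      rw [Nat.cast_pred h]
      exact div_le_div_of_nonneg_right (by linarith) hq'.le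
  have right_le : ((q - 1 - w - 1 : ℕ) : ℝ) / q ≤ max 0 (1 - y) := by
    rcases lt_or_ge (w + 1) q with h | h
    · refine le_max_of_le_right ?_
      rw [one_sub_div hq'.ne', Nat.sub_sub, Nat.sub_sub, Nat.cast_sub (by omega)]
      push_cast
      exact div_le_div_of_nonneg_right (by linarith) hq'.le
    · simp [show q - 1 - w - 1 = 0 by omega]
  have min_le := min_le_norm_unitAddCircle y
  have norm_nonneg := norm_nonneg (y : UnitAddCircle)
  rw [norm_eq]
  rcases le_total y (1 - y) with h | h
  · rw [min_eq_left h] at min_le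
    exact le_add_of_le_of_nonneg (geomMeanBound_anti N (by positivity)
      (left_le.trans (max_le norm_nonneg min_le))) (g_nonneg _)
  · rw [min_eq_right h] at min_le
    exact le_add_of_nonneg_of_le (g_nonneg _) (geomMeanBound_anti N (by positivity)
      (right_le.trans (max_le norm_nonneg min_le)))

lemma natCast_mul_sum_block_geomMeanBound_le {α : ℝ} {a : ℤ} {q : ℕ} (hq : 1 ≤ q)
    (haq : IsCoprime a (q : ℤ)) (hα : |α - a / q| ≤ 1 / (q : ℝ) ^ 2) (N r₀ : ℕ) :
    N * ∑ u ∈ Finset.range q, geomMeanBound N ‖((α * (r₀ + u : ℕ) : ℝ) : UnitAddCircle)‖ ≤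
      8 * N + 4 * q * (1 + Real.log q) := by
  have : NeZero q := ⟨by omega⟩
  obtain ⟨b, hb⟩ := exists_mul_add_eq_val_add_div hq hα r₀
  set G : ℕ → ℝ := fun v => geomMeanBound N (((v - 1 : ℕ) : ℝ) / q)
  have term_le : ∀ u ∈ Finset.range q,
      geomMeanBound N ‖((α * (r₀ + u : ℕ) : ℝ) : UnitAddCircle)‖ ≤
        G ((a : ZMod q) * u + b).val + G (q - 1 - ((a : ZMod q) * u + b).val) := by
    intro u hu
    obtain ⟨z, ψ, hψ₁, hψ₂, hx⟩ := hb u (Finset.mem_range.1 hu)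
    exact geomMeanBound_norm_le N (ZMod.val_lt _) hψ₁ hψ₂ hx
  have ha : IsUnit (a : ZMod q) := (ZMod.coe_int_isUnit_iff_isCoprime a q).2 haq.symm
  calc _ ≤ N * ∑ u ∈ Finset.range q,
        (G ((a : ZMod q) * u + b).val + G (q - 1 - ((a : ZMod q) * u + b).val)) := by
        gcongr with u hu; exact term_le u hu
    _ = N * ∑ v ∈ Finset.range q, G v + N * ∑ v ∈ Finset.range q, G v := by
        rw [sum_range_val_mul_add ha b fun w => G w + G (q - 1 - w), Finset.sum_add_distrib,
          Finset.sum_range_reflect, mul_add]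
    _ ≤ 8 * N + 4 * q * (1 + Real.log q) := by linarith [natCast_mul_sum_geomMeanBound_le N hq]

lemma sum_Icc_le_of_block_le {F : ℕ → ℝ} (hF : ∀ r, 0 ≤ F r) {q : ℕ} (hq : 1 ≤ q) {B : ℝ}
    (hB : ∀ r₀, ∑ u ∈ Finset.range q, F (r₀ + u) ≤ B) (R : ℕ) :
    ∑ r ∈ Finset.Icc 1 R, F r ≤ ((R : ℝ) / q + 1) * B := by
  have blocks_le (j : ℕ) : ∑ r ∈ Finset.range (j * q), F r ≤ j * B := by
    induction j with
    | zero => simp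
    | succ j ih =>
      rw [Nat.succ_mul, Finset.sum_range_add]
      push_cast
      linarith [hB (j * q)]
  have hB_nonneg : 0 ≤ B := (Finset.sum_nonneg fun _ _ => hF _).trans (hB 0)
  have Icc_subset : Finset.Icc 1 R ⊆ Finset.range ((R / q + 1) * q) := fun r hr =>
    Finset.mem_range.2 ((Finset.mem_Icc.1 hr).2.trans_lt
      ((Nat.div_lt_iff_lt_mul hq).1 (Nat.lt_succ_self _)))
  calc ∑ r ∈ Finset.Icc 1 R, F r ≤ ∑ r ∈ Finset.range ((R / q + 1) * q), F r :=
        Finset.sum_le_sum_of_subset_of_nonneg Icc_subset fun r _ _ => hF r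
    _ ≤ ((R / q + 1 : ℕ) : ℝ) * B := blocks_le _
    _ ≤ ((R : ℝ) / q + 1) * B := by
        push_cast
        gcongr
        exact Nat.cast_div_le

lemma natCast_mul_sum_geomMeanBound_mul_le {α : ℝ} {a : ℤ} {q : ℕ} (hq : 1 ≤ q)
    (haq : IsCoprime a (q : ℤ)) (hα : |α - a / q| ≤ 1 / (q : ℝ) ^ 2) (N R : ℕ) {D : ℕ}
    (hD : 1 ≤ D) :
    N * ∑ r ∈ Finset.Icc 1 R, geomMeanBound N ‖((D * α * r : ℝ) : UnitAddCircle)‖ ≤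
      ((D * R : ℝ) / q + 1) * (8 * N + 4 * q * (1 + Real.log q)) := by
  set F : ℕ → ℝ := fun r => N * geomMeanBound N ‖((α * r : ℝ) : UnitAddCircle)‖
  have hF (r : ℕ) : 0 ≤ F r :=
    mul_nonneg N.cast_nonneg (geomMeanBound_nonneg N (norm_nonneg _))
  have blocks := sum_Icc_le_of_block_le hF hq (fun r₀ => by
    rw [← Finset.mul_sum]
    exact natCast_mul_sum_block_geomMeanBound_le hq haq hα N r₀) (D * R)
  calc N * ∑ r ∈ Finset.Icc 1 R, geomMeanBound N ‖((D * α * r : ℝ) : UnitAddCircle)‖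
      = ∑ r ∈ Finset.Icc 1 R, F (D * r) := by
        rw [Finset.mul_sum]
        refine Finset.sum_congr rfl fun r _ => ?_
        simp only [F]
        push_cast
        rw [mul_comm (D : ℝ) α, mul_assoc]
    _ = ∑ r ∈ (Finset.Icc 1 R).image (D * ·), F r :=
        (Finset.sum_image fun x _ y _ h => Nat.eq_of_mul_eq_mul_left hD h).symm
    _ ≤ ∑ r ∈ Finset.Icc 1 (D * R), F r := by
        refine Finset.sum_le_sum_of_subset_of_nonneg (Finset.image_subset_iff.2 fun r hr => ?_)
          fun r _ _ => hF r
        rw [Finset.mem_Icc] at hr ⊢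
        exact ⟨Nat.mul_pos hD hr.1, Nat.mul_le_mul_left D hr.2⟩
    _ ≤ _ := by exact_mod_cast blocks

lemma one_div_two_mul_le_norm_unitAddCircle {α : ℝ} {a : ℤ} {q : ℕ} (hq : 2 ≤ q)
    (haq : IsCoprime a (q : ℤ)) (hα : |α - a / q| ≤ 1 / (q : ℝ) ^ 2) :
    1 / (2 * (q : ℝ)) ≤ ‖(α : UnitAddCircle)‖ := by
  have hq2 : (2 : ℝ) ≤ q := by exact_mod_cast hq
  have hq' : (0 : ℝ) < q := by linarith
  have not_dvd : a - q * round α ≠ 0 := by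
    intro h
    have hunit := haq.isUnit_of_dvd' (⟨round α, by linarith⟩ : (q : ℤ) ∣ a) dvd_rfl
    rw [Int.isUnit_iff] at hunit
    omega
  have far_from_integer : 1 / (q : ℝ) ≤ |(a : ℝ) / q - round α| := by
    have : (1 : ℝ) ≤ |(a : ℝ) - q * round α| := by exact_mod_cast Int.one_le_abs not_dvd
    rw [show (a : ℝ) / q - round α = (a - q * round α) / q by field_simp, abs_div,
      abs_of_pos hq']
    gcongr
  have sq_le : 1 / (q : ℝ) ^ 2 ≤ 1 / (2 * q) :=
    one_div_le_one_div_of_le (by positivity) (by nlinarith)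
  have halves : 1 / (q : ℝ) = 1 / (2 * q) + 1 / (2 * q) := by field_simp; norm_num
  rw [UnitAddCircle.norm_eq]
  have triangle := abs_sub_le ((a : ℝ) / q) α (round α)
  rw [abs_sub_comm _ α] at triangle
  linarith

lemma norm_sum_fourierChar_div_le_one (N : ℕ) (f : ℕ → ℝ) {L : ℕ} (hL : L ≤ N) :
    ‖∑ m ∈ Finset.range L, (𝐞 (f m) : ℂ)‖ / N ≤ 1 :=
  div_le_one_of_le₀ ((norm_sum_fourierChar_le L f).trans (by exact_mod_cast hL)) N.cast_nonneg

lemma norm_sum_linear_div_le {f : ℝ[X]} (hf : f.natDegree ≤ 1) {a : ℤ} {q : ℕ} (hq : 1 ≤ q)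
    (haq : IsCoprime a (q : ℤ)) (hα : |f.coeff 1 - a / q| ≤ 1 / (q : ℝ) ^ 2) {L N : ℕ}
    (hL : L ≤ N) :
    ‖∑ m ∈ Finset.range L, (𝐞 (f.eval (m : ℝ)) : ℂ)‖ / N ≤ 8 * (1 / q + q / N) := by
  have trivial_bound := norm_sum_fourierChar_div_le_one N (fun m => f.eval (m : ℝ)) hL
  have ratio_nonneg : (0 : ℝ) ≤ q / N := by positivity
  rcases hq.eq_or_lt with rfl | hq2
  · rw [Nat.cast_one] at ratio_nonneg ⊢
    linarith
  rcases N.eq_zero_or_pos with rfl | hN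
  · simp
  have norm_ge := one_div_two_mul_le_norm_unitAddCircle hq2 haq hα
  have bound := pow_norm_sum_fourierChar_eval_le N 0 hf hL
  simp only [productMean, pow_zero, pow_one, zero_add, Nat.factorial_one, Nat.cast_one, one_mul,
    mul_one] at bound
  calc _ ≤ _ := bound
    _ ≤ 2 * geomMeanBound N (1 / (2 * q)) := by
      gcongr; exact geomMeanBound_anti N (by positivity) norm_ge
    _ = 2 * (N * geomMeanBound N (1 / (2 * q))) / N := by field_simp
    _ ≤ 2 * (2 / (1 / (2 * q))) / N := by gcongr; exact mul_geomMeanBound_le N (by positivity)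
    _ = 8 * (q / N) := by field_simp; norm_num
    _ ≤ 8 * (1 / q + q / N) := by gcongr; exact le_add_of_nonneg_left (by positivity)

lemma exists_productMean_le (k : ℕ) {ε : ℝ} (hε : 0 < ε) :
    ∃ C : ℝ, 0 < C ∧ ∀ N : ℕ, 1 ≤ N → ∀ F : ℕ → ℝ, (∀ r, 0 ≤ F r) →
      productMean N k F ≤
        k / N * F 0 + C * (N : ℝ) ^ ε * ((∑ r ∈ Finset.Icc 1 (N ^ k), F r) / N ^ k) := by
  set η : ℝ := ε / (k ^ 2 + 1)
  have hη : 0 < η := by positivity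
  obtain ⟨C, hC, hdiv⟩ := exists_card_divisors_le_mul_rpow hη
  refine ⟨C ^ k, by positivity, fun N hN F hF => (productMean_le N k hF).trans ?_⟩
  have hN' : (1 : ℝ) ≤ N := by exact_mod_cast hN
  have exponent_le : k * η * k ≤ ε := by
    rw [show k * η * k = k ^ 2 * ε / ((k : ℝ) ^ 2 + 1) by ring, div_le_iff₀ (by positivity)]
    linarith
  rw [mul_div_assoc', Finset.mul_sum]
  gcongr with r hr
  · exact hF r
  obtain ⟨hr1, hrN⟩ := Finset.mem_Icc.1 hr
  calc (r.divisors.card : ℝ) ^ k ≤ (C * (r : ℝ) ^ η) ^ k := by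
        gcongr; exact hdiv r (by omega)
    _ ≤ (C * ((N : ℝ) ^ k) ^ η) ^ k := by gcongr; exact_mod_cast hrN
    _ = C ^ k * (N : ℝ) ^ (k * η * k) := by
        rw [mul_pow, ← Real.rpow_natCast (N : ℝ) k, ← Real.rpow_mul (by positivity),
          ← Real.rpow_mul_natCast (by positivity)]
    _ ≤ C ^ k * (N : ℝ) ^ ε := by gcongr

lemma exists_one_add_log_le (m : ℕ) {ε : ℝ} (hε : 0 < ε) :
    ∃ C : ℝ, 1 ≤ C ∧ ∀ q N : ℕ, 1 ≤ q → 1 ≤ N → q ≤ N ^ m →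
      1 + Real.log q ≤ C * (N : ℝ) ^ ε := by
  refine ⟨1 + m / ε, le_add_of_nonneg_right (by positivity), fun q N hq hN hqN => ?_⟩
  have one_le : 1 ≤ (N : ℝ) ^ ε := Real.one_le_rpow (by exact_mod_cast hN) hε.le
  calc 1 + Real.log q ≤ 1 + Real.log ((N : ℝ) ^ m) := by
        gcongr; exact_mod_cast hqN
    _ = 1 + m * Real.log N := by rw [Real.log_pow]
    _ ≤ (N : ℝ) ^ ε + m * ((N : ℝ) ^ ε / ε) := by
        gcongr; exact Real.log_le_rpow_div N.cast_nonneg hε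
    _ = (1 + m / ε) * (N : ℝ) ^ ε := by ring

lemma mean_geomMeanBound_le {α : ℝ} {a : ℤ} {q : ℕ} (hq : 1 ≤ q) (haq : IsCoprime a (q : ℤ))
    (hα : |α - a / q| ≤ 1 / (q : ℝ) ^ 2) {D : ℕ} (hD : 1 ≤ D) {N : ℕ} (hN : 1 ≤ N) (k : ℕ) :
    (∑ r ∈ Finset.Icc 1 (N ^ (k + 1)), geomMeanBound N ‖((D * α * r : ℝ) : UnitAddCircle)‖) /
        N ^ (k + 1) ≤
      16 * D * (1 + Real.log q) * (1 / q + 1 / N + q / N ^ (k + 2)) := by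
  have hN' : (1 : ℝ) ≤ N := by exact_mod_cast hN
  have hN₀ : (0 : ℝ) < N := by linarith
  have hD' : (1 : ℝ) ≤ D := by exact_mod_cast hD
  set Λ : ℝ := 1 + Real.log q
  have hΛ : 1 ≤ Λ := le_add_of_nonneg_right (Real.log_natCast_nonneg q)
  have bound := natCast_mul_sum_geomMeanBound_mul_le hq haq hα N (N ^ (k + 1)) hD
  push_cast at bound
  have inv_pow_le : 1 / (N : ℝ) ^ (k + 1) ≤ 1 / N :=
    one_div_le_one_div_of_le hN₀ (le_self_pow₀ hN' k.succ_ne_zero)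
  set M : ℝ := (N : ℝ) ^ (k + 1)
  have hM : 0 < M := by positivity
  calc _ = N * (∑ r ∈ Finset.Icc 1 (N ^ (k + 1)),
        geomMeanBound N ‖((D * α * r : ℝ) : UnitAddCircle)‖) / (N * M) := by field_simp
    _ ≤ (D * M / q + 1) * (8 * N + 4 * q * Λ) / (N * M) := by gcongr
    _ ≤ (D * M / q + D) * (8 * Λ * (N + q)) / (N * M) := by
        have : (N : ℝ) ≤ Λ * N := le_mul_of_one_le_left hN₀.le hΛ
        have : 0 ≤ q * Λ := by positivity
        gcongr
        linarith
    _ = 8 * D * Λ * (1 / q + 1 / M + 1 / N + q / N ^ (k + 2)) := by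
        rw [show (N : ℝ) ^ (k + 2) = N * M by ring]
        field_simp
        ring
    _ ≤ 8 * D * Λ * (2 * (1 / q + 1 / N + q / N ^ (k + 2))) := by
        gcongr
        have : 0 ≤ 1 / (q : ℝ) + q / N ^ (k + 2) := by positivity
        linarith
    _ = 16 * D * Λ * (1 / q + 1 / N + q / N ^ (k + 2)) := by ring

lemma exists_weyl_inequality_of_two_le (k : ℕ) {ε : ℝ} (hε : 0 < ε) :
    ∃ C : ℝ, 0 < C ∧ ∀ (f : ℝ[X]) (a : ℤ) (q N L : ℕ), f.natDegree ≤ k + 2 → 1 ≤ q →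
      IsCoprime a (q : ℤ) → |f.coeff (k + 2) - a / q| ≤ 1 / (q : ℝ) ^ 2 → 1 ≤ N →
      q ≤ N ^ (k + 2) → L ≤ N →
      (‖∑ m ∈ Finset.range L, (𝐞 (f.eval (m : ℝ)) : ℂ)‖ / N) ^ 2 ^ (k + 1) ≤
        C * (N : ℝ) ^ ε * (1 / q + 1 / N + q / N ^ (k + 2)) := by
  obtain ⟨C₁, hC₁, hmean⟩ := exists_productMean_le (k + 1) (half_pos hε)
  obtain ⟨C₂, hC₂, hlog⟩ := exists_one_add_log_le (k + 2) (half_pos hε)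
  set D : ℕ := (k + 2).factorial
  refine ⟨2 ^ 2 ^ (k + 1) * (2 * (k + 1) + C₁ * 16 * D * C₂), by positivity,
    fun f a q N L hf hq haq hα hN hqN hL => ?_⟩
  have hD : 1 ≤ D := Nat.factorial_pos _
  set F : ℕ → ℝ := fun r => geomMeanBound N ‖((D * f.coeff (k + 2) * r : ℝ) : UnitAddCircle)‖
  set E : ℝ := 1 / q + 1 / N + q / N ^ (k + 2)
  have hE : 1 / (N : ℝ) ≤ E := by
    have : (0 : ℝ) ≤ 1 / q + q / N ^ (k + 2) := by positivity
    simp only [E]; linarith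
  have hE₀ : 0 ≤ E := le_trans (by positivity) hE
  have one_le : 1 ≤ (N : ℝ) ^ ε := Real.one_le_rpow (by exact_mod_cast hN) hε.le
  have mean_F_le : (∑ r ∈ Finset.Icc 1 (N ^ (k + 1)), F r) / N ^ (k + 1) ≤
      16 * D * (C₂ * (N : ℝ) ^ (ε / 2)) * E := by
    refine (mean_geomMeanBound_le hq haq hα hD hN k).trans ?_
    gcongr
    exact hlog q N hq hN hqN
  rw [mul_assoc, mul_assoc (2 ^ 2 ^ (k + 1))]
  refine (pow_norm_sum_fourierChar_eval_le N (k + 1) hf hL).trans ?_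
  gcongr
  calc productMean N (k + 1) F
      ≤ (k + 1 : ℕ) / N * F 0 +
          C₁ * (N : ℝ) ^ (ε / 2) * ((∑ r ∈ Finset.Icc 1 (N ^ (k + 1)), F r) / N ^ (k + 1)) :=
        hmean N hN F fun r => geomMeanBound_nonneg N (norm_nonneg _)
    _ ≤ (k + 1 : ℕ) / N * 2 +
          C₁ * (N : ℝ) ^ (ε / 2) * (16 * D * (C₂ * (N : ℝ) ^ (ε / 2)) * E) := by
        gcongr
        exact geomMeanBound_le_two N (norm_nonneg _)
    _ = 2 * (k + 1) * (1 / N) + C₁ * 16 * D * C₂ * ((N : ℝ) ^ ε * E) := by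
        rw [← add_halves ε, Real.rpow_add (by exact_mod_cast hN)]
        simp only [add_halves]
        push_cast; ring
    _ ≤ 2 * (k + 1) * ((N : ℝ) ^ ε * E) + C₁ * 16 * D * C₂ * ((N : ℝ) ^ ε * E) := by
        gcongr
        exact hE.trans (le_mul_of_one_le_left hE₀ one_le)
    _ = (2 * (k + 1) + C₁ * 16 * D * C₂) * ((N : ℝ) ^ ε * E) := by ring

lemma exists_weyl_inequality (k : ℕ) {ε : ℝ} (hε : 0 < ε) :
    ∃ C : ℝ, 0 < C ∧ ∀ (f : ℝ[X]) (a : ℤ) (q N L : ℕ), f.natDegree ≤ k + 1 → 1 ≤ q →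
      IsCoprime a (q : ℤ) → |f.coeff (k + 1) - a / q| ≤ 1 / (q : ℝ) ^ 2 → L ≤ N →
      (‖∑ m ∈ Finset.range L, (𝐞 (f.eval (m : ℝ)) : ℂ)‖ / N) ^ 2 ^ k ≤
        C * (N : ℝ) ^ ε * (1 / q + 1 / N + q / N ^ (k + 1)) := by
  have one_le_rpow {N : ℕ} (hN : 1 ≤ N) : 1 ≤ (N : ℝ) ^ ε :=
    Real.one_le_rpow (by exact_mod_cast hN) hε.le
  cases k with
  | zero =>
    refine ⟨8, by norm_num, fun f a q N L hf hq haq hα hL => ?_⟩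
    rcases N.eq_zero_or_pos with rfl | hN
    · simp [Real.zero_rpow hε.ne']
    have bound := norm_sum_linear_div_le hf hq haq hα hL
    rw [pow_zero, pow_one, zero_add, pow_one]
    calc _ ≤ _ := bound
      _ ≤ 8 * 1 * (1 / q + 1 / N + q / N : ℝ) := by
        rw [mul_one]; gcongr; exact le_add_of_nonneg_right (by positivity)
      _ ≤ _ := by gcongr; exact one_le_rpow hN
  | succ k =>
    obtain ⟨C, hC, bound⟩ := exists_weyl_inequality_of_two_le k hε
    refine ⟨max C 1, by positivity, fun f a q N L hf hq haq hα hL => ?_⟩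
    rcases N.eq_zero_or_pos with rfl | hN
    · simp [Real.zero_rpow hε.ne']
    rcases le_or_gt q (N ^ (k + 2)) with hqN | hqN
    · refine (bound f a q N L hf hq haq hα hN hqN hL).trans ?_
      gcongr
      exact le_max_left C 1
    · have trivial_bound := norm_sum_fourierChar_div_le_one N (fun m => f.eval (m : ℝ)) hL
      have one_le_ratio : 1 ≤ (q : ℝ) / N ^ (k + 2) :=
        (one_le_div (by positivity)).2 (by exact_mod_cast hqN.le)
      have one_le_sum : 1 ≤ (1 / q + 1 / N + q / N ^ (k + 1 + 1) : ℝ) :=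
        one_le_ratio.trans (le_add_of_nonneg_left (by positivity))
      exact (pow_le_one₀ (by positivity) trivial_bound).trans
        (one_le_mul_of_one_le_of_one_le
          (one_le_mul_of_one_le_of_one_le (le_max_right C 1) (one_le_rpow hN)) one_le_sum)

lemma fourierZ_eq_linearCombination (f : ℤ →₀ ℂ) (α : ℝ) :
    fourierZ f α =
      Finsupp.linearCombination ℂ (fun x : ℤ => (starRingEnd ℂ) (𝐞 (α * x) : ℂ)) f := by
  rw [Finsupp.linearCombination_apply]
  refine Finsupp.sum_congr fun x _ => ?_
  rw [smul_eq_mul, ← Circle.coe_inv_eq_conj, ← AddChar.map_neg_eq_inv, Real.fourierChar_apply]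
  push_cast
  ring_nf

lemma fourierZ_sub (f g : ℤ →₀ ℂ) (α : ℝ) :
    fourierZ (f - g) α = fourierZ f α - fourierZ g α := by
  simp only [fourierZ_eq_linearCombination, map_sub]

/-- The mean `(1 / t) ∑_{m = 1}^{t} e(α p(m))` of the exponential sum with phase `α p`. The
sum is indexed by `range t`, hence the shift of the argument. -/
noncomputable def weylMean (p : ℝ[X]) (t : ℕ) (α : ℝ) : ℂ :=
  (∑ m ∈ Finset.range t, (𝐞 (α * p.eval (m + 1 : ℝ)) : ℂ)) / t

lemma fourierZ_kernelK (P : ℤ[X]) (t : ℕ) (α : ℝ) :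
    fourierZ (kernelK P t) α =
      (starRingEnd ℂ) (weylMean (P.map (Int.castRingHom ℝ)) t α) := by
  have eval_cast (m : ℕ) : (P.map (Int.castRingHom ℝ)).eval (m + 1 : ℝ) = P.eval (m + 1 : ℤ) := by
    simpa using eval_intCast_map (Int.castRingHom ℝ) P (m + 1)
  have sum_Icc : ∑ m ∈ Finset.Icc 1 t, Finsupp.single (P.eval (m : ℤ)) (1 : ℂ) =
      ∑ m ∈ Finset.range t, Finsupp.single (P.eval (m + 1 : ℤ)) 1 := by
    rw [← Finset.Ico_add_one_right_eq_Icc, Finset.sum_Ico_eq_sum_range]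
    simp only [Nat.add_sub_cancel, Nat.cast_add, Nat.cast_one, add_comm]
  simp only [kernelK, sum_Icc, fourierZ_eq_linearCombination, map_smul, map_sum,
    Finsupp.linearCombination_single, weylMean, map_div₀, map_natCast, eval_cast,
    smul_eq_mul, one_mul]
  rw [one_div, div_eq_inv_mul]

lemma fourierZ_kernelC_sub_kernelC (P : ℤ[X]) (n t u : ℕ) (α : ℝ) :
    fourierZ (kernelC P n t - kernelC P n u) α = fourierZ (kernelK P t - kernelK P u) α := by
  simp only [kernelC, sub_sub_sub_cancel_right]

lemma norm_fourierZ_kernelK_sub (P : ℤ[X]) (t u : ℕ) (α : ℝ) :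
    ‖fourierZ (kernelK P t - kernelK P u) α‖ =
      ‖weylMean (P.map (Int.castRingHom ℝ)) t α - weylMean (P.map (Int.castRingHom ℝ)) u α‖ := by
  rw [fourierZ_sub, fourierZ_kernelK, fourierZ_kernelK, ← map_sub, Complex.norm_conj]

lemma norm_weylMean_eq (p : ℝ[X]) (t : ℕ) (α : ℝ) :
    ‖weylMean p t α‖ = ‖∑ m ∈ Finset.range t, (𝐞 (α * p.eval (m + 1 : ℝ)) : ℂ)‖ / t := by
  rw [weylMean, norm_div, Complex.norm_natCast]

lemma norm_weylMean_le_one (p : ℝ[X]) (t : ℕ) (α : ℝ) : ‖weylMean p t α‖ ≤ 1 := by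
  rw [norm_weylMean_eq]
  exact norm_sum_fourierChar_div_le_one t _ le_rfl

lemma norm_weylMean_sub_succ_le (p : ℝ[X]) {t : ℕ} (ht : 1 ≤ t) (α : ℝ) :
    ‖weylMean p t α - weylMean p (t + 1) α‖ ≤ 2 / t := by
  have ht' : (t : ℂ) ≠ 0 := by exact_mod_cast (by omega : t ≠ 0)
  have ht'' : (t : ℂ) + 1 ≠ 0 := by exact_mod_cast t.succ_ne_zero
  have difference : weylMean p t α - weylMean p (t + 1) α =
      (weylMean p t α - 𝐞 (α * p.eval (t + 1 : ℝ))) / (t + 1 : ℕ) := by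
    rw [weylMean, weylMean, Finset.sum_range_succ]
    push_cast
    field_simp
    ring
  rw [difference, norm_div, Complex.norm_natCast]
  gcongr
  · calc _ ≤ ‖weylMean p t α‖ + ‖(𝐞 (α * p.eval (t + 1 : ℝ)) : ℂ)‖ := norm_sub_le _ _
      _ ≤ 1 + 1 := add_le_add (norm_weylMean_le_one p t α) (Circle.norm_coe _).le
      _ = 2 := by norm_num
  · exact t.le_succ

lemma norm_weylMean_two_pow_sub_le (p : ℝ[X]) {n t : ℕ} (ht : 2 ^ n ≤ t) (α : ℝ) :
    ‖weylMean p t α - weylMean p (t + 1) α‖ ≤ 2 * (2 : ℝ) ^ (-(n : ℝ)) := by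
  refine (norm_weylMean_sub_succ_le p (Nat.one_le_two_pow.trans ht) α).trans ?_
  rw [Real.rpow_neg zero_le_two, Real.rpow_natCast, ← div_eq_mul_inv]
  gcongr
  exact_mod_cast ht

lemma exists_norm_weylMean_pow_le {p : ℝ[X]} (hp : 1 ≤ p.natDegree) {ε : ℝ} (hε : 0 < ε) :
    ∃ C : ℝ, 0 < C ∧ ∀ (α : ℝ) (a : ℤ) (q N : ℕ), 1 ≤ q → IsCoprime a (q : ℤ) →
      |p.leadingCoeff * α - a / q| ≤ 1 / (q : ℝ) ^ 2 →
      ‖weylMean p N α‖ ^ 2 ^ (p.natDegree - 1) ≤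
        C * (N : ℝ) ^ ε * (1 / q + 1 / N + q / N ^ p.natDegree) := by
  obtain ⟨k, hk⟩ : ∃ k, p.natDegree = k + 1 := ⟨p.natDegree - 1, by omega⟩
  obtain ⟨C₁, hC₁, weyl⟩ := exists_weyl_inequality k hε
  refine ⟨C₁, hC₁, fun α a q N hq haq hα => ?_⟩
  have degree_le : (C α * taylor 1 p).natDegree ≤ k + 1 := by
    rw [← hk, ← natDegree_taylor p 1]
    exact natDegree_C_mul_le _ _
  have coeff_eq : (C α * taylor 1 p).coeff (k + 1) = p.leadingCoeff * α := by
    rw [coeff_C_mul, ← hk, coeff_taylor_natDegree, mul_comm]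
  have bound := weyl (C α * taylor 1 p) a q N N degree_le hq haq (by rwa [coeff_eq]) le_rfl
  simp only [eval_mul, eval_C, taylor_eval] at bound
  rwa [norm_weylMean_eq, hk, Nat.add_sub_cancel]

lemma exists_norm_weylMean_le {p : ℝ[X]} (hp : 1 ≤ p.natDegree) {ε : ℝ} (hε : 0 < ε) :
    ∃ C : ℝ, 0 < C ∧ ∀ (α : ℝ) (a : ℤ) (q N : ℕ) (X : ℝ), IsCoprime a (q : ℤ) →
      |p.leadingCoeff * α - a / q| ≤ 1 / (q : ℝ) ^ 2 → 0 < X → X ≤ q → X ≤ N →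
      q * X ≤ N ^ p.natDegree →
      ‖weylMean p N α‖ ≤ C * ((N : ℝ) ^ ε / X) ^ ((2 ^ (p.natDegree - 1) : ℝ)⁻¹) := by
  obtain ⟨C, hC, weyl⟩ := exists_norm_weylMean_pow_le hp hε
  refine ⟨(3 * C) ^ ((2 ^ (p.natDegree - 1) : ℝ)⁻¹), by positivity,
    fun α a q N X haq hα hX hXq hXN hqX => ?_⟩
  have hq : (0 : ℝ) < q := hX.trans_le hXq
  have hN : (0 : ℝ) < N := hX.trans_le hXN
  rw [← Real.mul_rpow (by positivity) (by positivity),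
    Real.le_rpow_inv_iff_of_pos (norm_nonneg _) (by positivity) (by positivity)]
  calc ‖weylMean p N α‖ ^ (2 ^ (p.natDegree - 1) : ℝ)
      = ‖weylMean p N α‖ ^ 2 ^ (p.natDegree - 1) := by rw [← Real.rpow_natCast]; norm_cast
    _ ≤ C * (N : ℝ) ^ ε * (1 / q + 1 / N + q / N ^ p.natDegree) :=
        weyl α a q N (by exact_mod_cast hq) haq hα
    _ ≤ C * (N : ℝ) ^ ε * (1 / X + 1 / X + 1 / X) := by
        have : q / (N : ℝ) ^ p.natDegree ≤ 1 / X := by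
          rwa [div_le_div_iff₀ (by positivity) hX, one_mul]
        gcongr
    _ = 3 * C * ((N : ℝ) ^ ε / X) := by ring

lemma arcDist_emod_le (P : ℤ[X]) {a : ℤ} {q : ℕ} (hq : 1 ≤ q) (haq : IsCoprime a (q : ℤ)) {α : ℝ}
    (hα : |P.leadingCoeff * α - a / q| < 1 / q) :
    arcDist P (a % q).toNat q α ≤ |P.leadingCoeff * α - a / q| := by
  unfold arcDist
  split_ifs with hq_one
  · subst hq_one
    simpa using round_le (P.leadingCoeff * α : ℝ) a
  have hq₀ : (0 : ℝ) < q := by exact_mod_cast hq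
  have emod_nonneg : 0 ≤ a % q := Int.emod_nonneg a (by omega)
  have emod_lt : a % q + 1 ≤ q := Int.emod_lt_of_pos a (by omega)
  have one_le_emod : 1 ≤ a % q := by
    refine emod_nonneg.lt_of_ne' fun emod_eq_zero => hq_one ?_
    have isUnit_q := haq.isUnit_of_dvd' (Int.dvd_of_emod_eq_zero emod_eq_zero) dvd_rfl
    exact_mod_cast Int.isUnit_iff.1 isUnit_q |>.resolve_right (by omega)
  have emod_toNat : ((a % q).toNat : ℝ) = (a % q : ℤ) := by
    exact_mod_cast Int.toNat_of_nonneg emod_nonneg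
  have div_eq : (a : ℝ) / q = (a / q : ℤ) + (a % q : ℤ) / q := by
    rw [add_div' _ _ _ hq₀.ne']
    congr 1
    exact_mod_cast (Int.ediv_mul_add_emod a q).symm
  have lower : 1 / (q : ℝ) ≤ (a % q : ℤ) / q := by gcongr; exact_mod_cast one_le_emod
  have upper : ((a % q : ℤ) : ℝ) / q + 1 / q ≤ 1 := by
    rw [← add_div, div_le_one hq₀]; exact_mod_cast emod_lt
  have floor_eq : ⌊(P.leadingCoeff * α : ℝ)⌋ = a / q := by
    rw [Int.floor_eq_iff]
    constructor <;> linarith [(abs_lt.1 hα).1, (abs_lt.1 hα).2]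
  refine le_of_eq ?_
  rw [Int.fract, floor_eq, emod_toNat, div_eq, sub_sub]

lemma emod_mem_ratShell {a : ℤ} {q : ℕ} (hq : 1 ≤ q) (haq : IsCoprime a (q : ℤ)) :
    ((a % q).toNat, q) ∈ ratShell (Nat.log 2 q) := by
  have emod_nonneg : 0 ≤ a % q := Int.emod_nonneg a (by omega)
  have emod_lt : a % q < q := Int.emod_lt_of_pos a (by omega)
  refine ⟨by simp only; omega, ?_, Nat.pow_log_le_self 2 (by omega),
    Nat.lt_pow_succ_log_self one_lt_two q⟩
  rw [← Nat.isCoprime_iff_coprime, Int.toNat_of_nonneg emod_nonneg]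
  rwa [← Int.ediv_mul_add_emod a q, IsCoprime.mul_add_right_left_iff] at haq

lemma mem_majorArcs_of_abs_sub_lt {P : ℤ[X]} {δ : ℝ} {n : ℕ} {α : ℝ} {a : ℤ} {q : ℕ} (hq : 1 ≤ q)
    (haq : IsCoprime a (q : ℤ)) (hα : |P.leadingCoeff * α - a / q| < 1 / q)
    (hα' : |P.leadingCoeff * α - a / q| < (2 : ℝ) ^ (-((n : ℝ) * ((P.natDegree : ℝ) - δ))))
    (hqn : (q : ℝ) ≤ 2 ^ (n * δ)) : α ∈ majorArcs P δ n := by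
  refine ⟨Nat.log 2 q, ?_, (a % q).toNat, q, emod_mem_ratShell hq haq,
    (arcDist_emod_le P hq haq hα).trans_lt hα'⟩
  rw [← Real.rpow_le_rpow_left_iff one_lt_two, Real.rpow_natCast]
  exact le_trans (by exact_mod_cast Nat.pow_log_le_self 2 (by omega)) hqn

lemma exists_approx_of_mem_minorArcs {P : ℤ[X]} {δ : ℝ} (hδ : δ ≤ P.natDegree) {n : ℕ} {α : ℝ}
    (hα : α ∈ minorArcs P δ n) :
    ∃ (a : ℤ) (q : ℕ), IsCoprime a (q : ℤ) ∧
      |P.leadingCoeff * α - a / q| ≤ 1 / (q : ℝ) ^ 2 ∧ (2 : ℝ) ^ (n * δ) ≤ q ∧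
      (q : ℝ) ≤ (2 : ℝ) ^ (n * (P.natDegree - δ)) := by
  set Y : ℝ := (2 : ℝ) ^ (n * (P.natDegree - δ)) with Y_def
  have one_le_Y : 1 ≤ Y :=
    Real.one_le_rpow one_le_two (mul_nonneg n.cast_nonneg (sub_nonneg.2 hδ))
  obtain ⟨r, approx, den_le⟩ := Real.exists_rat_abs_sub_le_and_den_le (P.leadingCoeff * α : ℝ)
    (Nat.floor_pos.2 one_le_Y)
  have den_pos : (0 : ℝ) < r.den := by exact_mod_cast r.den_pos
  have one_le_den : (1 : ℝ) ≤ r.den := by exact_mod_cast r.den_pos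
  have den_le_Y : (r.den : ℝ) ≤ Y := (Nat.le_floor_iff (by positivity)).1 den_le
  rw [Rat.cast_def] at approx
  have approx_lt : |P.leadingCoeff * α - r.num / r.den| < 1 / (Y * r.den) := by
    refine approx.trans_lt ?_
    gcongr
    exact Nat.lt_floor_add_one Y
  refine ⟨r.num, r.den, Rat.isCoprime_num_den r, ?_, ?_, den_le_Y⟩
  · refine approx_lt.le.trans ?_
    rw [sq]
    gcongr
  · by_contra! den_lt
    refine hα (mem_majorArcs_of_abs_sub_lt r.den_pos (Rat.isCoprime_num_den r)
      (approx_lt.trans_le ?_) (approx_lt.trans_le ?_) den_lt.le)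
    · gcongr
      exact le_mul_of_one_le_left den_pos.le one_le_Y
    · rw [Real.rpow_neg zero_le_two, ← Y_def, ← one_div]
      gcongr
      exact le_mul_of_one_le_right (by positivity) one_le_den

lemma rpow_le_two_mul_of_le_two_pow_succ {n t : ℕ} (ht : t ≤ 2 ^ (n + 1)) {ε : ℝ} (hε : 0 ≤ ε)
    (hε' : ε ≤ 1) : (t : ℝ) ^ ε ≤ 2 * 2 ^ (n * ε) := by
  calc (t : ℝ) ^ ε ≤ ((2 : ℝ) ^ (n + 1)) ^ ε := by gcongr; exact_mod_cast ht
    _ = 2 ^ ε * 2 ^ (n * ε) := by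
        rw [← Real.rpow_natCast_mul zero_le_two, ← Real.rpow_add zero_lt_two]
        push_cast; ring_nf
    _ ≤ 2 ^ (1 : ℝ) * 2 ^ (n * ε) := by gcongr; exact one_le_two
    _ = 2 * 2 ^ (n * ε) := by rw [Real.rpow_one]

lemma exists_norm_weylMean_le_of_mem_minorArcs {P : ℤ[X]} (hd : 1 ≤ P.natDegree) {δ : ℝ}
    (hδ : 0 < δ) (hδ' : δ ≤ 1) :
    ∃ ν : ℝ, 0 < ν ∧ ∃ C : ℝ, 0 < C ∧ ∀ n t : ℕ, 2 ^ n ≤ t → t ≤ 2 ^ (n + 1) →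
      ∀ α ∈ minorArcs P δ n,
        ‖weylMean (P.map (Int.castRingHom ℝ)) t α‖ ≤ C * (2 : ℝ) ^ (-((n : ℝ) * ν)) := by
  have natDegree_map := natDegree_map_eq_of_injective (Int.castRingHom ℝ).injective_int P
  have leadingCoeff_map := leadingCoeff_map_of_injective (Int.castRingHom ℝ).injective_int P
  obtain ⟨C, hC, weyl⟩ :=
    exists_norm_weylMean_le (p := P.map (Int.castRingHom ℝ)) (by rwa [natDegree_map]) (half_pos hδ)
  rw [natDegree_map, leadingCoeff_map] at weyl
  set κ : ℝ := (2 ^ (P.natDegree - 1))⁻¹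
  have hδd : δ ≤ P.natDegree := hδ'.trans (by exact_mod_cast hd)
  refine ⟨δ / 2 * κ, by positivity, C * 2 ^ κ, by positivity, fun n t hnt htn α hα => ?_⟩
  obtain ⟨a, q, haq, approx, le_q, q_le⟩ := exists_approx_of_mem_minorArcs hδd hα
  have two_pow_le : (2 : ℝ) ^ (n : ℝ) ≤ t := by rw [Real.rpow_natCast]; exact_mod_cast hnt
  have le_t : (2 : ℝ) ^ (n * δ) ≤ t :=
    (Real.rpow_le_rpow_of_exponent_le one_le_two
      (mul_le_of_le_one_right n.cast_nonneg hδ')).trans two_pow_le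
  have q_mul_le : q * (2 : ℝ) ^ (n * δ) ≤ t ^ P.natDegree :=
    calc q * (2 : ℝ) ^ (n * δ) ≤ 2 ^ (n * (P.natDegree - δ)) * 2 ^ (n * δ) := by gcongr
      _ = (2 ^ (n : ℝ)) ^ P.natDegree := by
          rw [← Real.rpow_add zero_lt_two, ← Real.rpow_mul_natCast zero_le_two]; ring_nf
      _ ≤ t ^ P.natDegree := by gcongr
  calc _ ≤ C * ((t : ℝ) ^ (δ / 2) / 2 ^ (n * δ)) ^ κ :=
        weyl α a q t _ haq approx (by positivity) le_q le_t q_mul_le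
    _ ≤ C * (2 * 2 ^ (n * (δ / 2)) / 2 ^ (n * δ)) ^ κ := by
        gcongr
        exact rpow_le_two_mul_of_le_two_pow_succ htn (by positivity) (by linarith)
    _ = C * (2 * 2 ^ (-(n * (δ / 2)))) ^ κ := by
        rw [mul_div_assoc, ← Real.rpow_sub zero_lt_two]; ring_nf
    _ = C * 2 ^ κ * 2 ^ (-(n * (δ / 2 * κ))) := by
        rw [Real.mul_rpow zero_le_two (by positivity), ← Real.rpow_mul zero_le_two]; ring_nf

lemma sum_range_mul_eq_by_parts {R : Type*} [Ring R] (v u : ℕ → R) (t : ℕ) :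
    ∑ m ∈ Finset.range t, v m * u m = (∑ m ∈ Finset.range t, v m) * u t -
      ∑ m ∈ Finset.range t, (∑ j ∈ Finset.range (m + 1), v j) * (u (m + 1) - u m) := by
  induction t with
  | zero => simp
  | succ t ih =>
    simp only [Finset.sum_range_succ _ t, ih]
    noncomm_ring

lemma norm_sum_mul_le_of_norm_sum_le {R : Type*} [SeminormedRing R] {v u : ℕ → R} {t : ℕ} {B : ℝ}
    (hv : ∀ n ≤ t, ‖∑ m ∈ Finset.range n, v m‖ ≤ B) :
    ‖∑ m ∈ Finset.range t, v m * u m‖ ≤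
      B * (‖u t‖ + ∑ m ∈ Finset.range t, ‖u (m + 1) - u m‖) := by
  rw [sum_range_mul_eq_by_parts, mul_add, Finset.mul_sum]
  refine (norm_sub_le _ _).trans (add_le_add ?_ (norm_sum_le_of_le _ fun m hm => ?_))
  · exact (norm_mul_le _ _).trans (by gcongr; exact hv t le_rfl)
  · exact (norm_mul_le _ _).trans (by gcongr; exact hv _ (Finset.mem_range.1 hm))

lemma fourierChar_sub_one_ne_zero {x : ℝ} (hx : 0 < x) (hx' : x ≤ 1 / 2) :
    (𝐞 x : ℂ) - 1 ≠ 0 := by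
  have := four_mul_abs_le_norm_fourierChar_sub_one (x := x) (by rwa [abs_of_pos hx])
  exact norm_pos_iff.1 (lt_of_lt_of_le (by positivity) this)

lemma norm_inv_fourierChar_sub_one_le {x : ℝ} (hx : 0 < x) (hx' : x ≤ 1 / 2) :
    ‖((𝐞 x : ℂ) - 1)⁻¹‖ ≤ 1 / (4 * x) := by
  rw [norm_inv, ← one_div]
  refine one_div_le_one_div_of_le (by positivity) ?_
  simpa only [abs_of_pos hx] using
    four_mul_abs_le_norm_fourierChar_sub_one (x := x) (by rwa [abs_of_pos hx])

lemma norm_inv_fourierChar_sub_one_sub_le {x y : ℝ} (hx : 0 < x) (hxy : x ≤ y) (hy : y ≤ 1 / 2) :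
    ‖((𝐞 y : ℂ) - 1)⁻¹ - ((𝐞 x : ℂ) - 1)⁻¹‖ ≤ 1 / 2 * (1 / x - 1 / y) := by
  have hy₀ : 0 < y := hx.trans_le hxy
  rw [inv_sub_inv' (fourierChar_sub_one_ne_zero hy₀ hy)
    (fourierChar_sub_one_ne_zero hx (hxy.trans hy)), norm_mul, norm_mul, sub_sub_sub_cancel_right]
  calc _ ≤ 1 / (4 * y) * (2 * Real.pi * |x - y|) * (1 / (4 * x)) := by
        gcongr
        · exact norm_inv_fourierChar_sub_one_le hy₀ hy
        · exact norm_fourierChar_sub_le x y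
        · exact norm_inv_fourierChar_sub_one_le hx (hxy.trans hy)
    _ ≤ 1 / (4 * y) * (2 * 4 * (y - x)) * (1 / (4 * x)) := by
        rw [abs_sub_comm, abs_of_nonneg (sub_nonneg.2 hxy)]
        have := sub_nonneg.2 hxy
        gcongr
        exact Real.pi_le_four
    _ = 1 / 2 * (1 / x - 1 / y) := by field_simp; ring

/-- Kusmin–Landau: divide by `e(Δ m) - 1` to write the terms as increments of `e(φ m)`, whose
partial sums are bounded, times weights of bounded variation. -/
lemma norm_sum_fourierChar_le_of_monotoneOn {φ : ℕ → ℝ} {L : ℕ} (hφ₀ : 0 < φ 1 - φ 0)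
    (hφ : MonotoneOn (fun m => φ (m + 1) - φ m) (Set.Iic L)) (hφL : φ (L + 1) - φ L ≤ 1 / 2) :
    ‖∑ m ∈ Finset.range L, (𝐞 (φ m) : ℂ)‖ ≤ 1 / (φ 1 - φ 0) := by
  set Δ : ℕ → ℝ := fun m => φ (m + 1) - φ m
  have Δ_pos {m : ℕ} (hm : m ≤ L) : 0 < Δ m :=
    hφ₀.trans_le (hφ (Set.mem_Iic.2 L.zero_le) hm m.zero_le)
  have Δ_le {m : ℕ} (hm : m ≤ L) : Δ m ≤ 1 / 2 := (hφ hm Set.self_mem_Iic hm).trans hφL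
  have term_eq {m : ℕ} (hm : m ≤ L) : (𝐞 (φ m) : ℂ) =
      ((𝐞 (φ (m + 1)) : ℂ) - 𝐞 (φ m)) * ((𝐞 (Δ m) : ℂ) - 1)⁻¹ := by
    rw [eq_mul_inv_iff_mul_eq₀ (fourierChar_sub_one_ne_zero (Δ_pos hm) (Δ_le hm)), mul_sub,
      mul_one, ← Circle.coe_mul, ← AddChar.map_add_eq_mul, add_sub_cancel]
  have telescoping (n : ℕ) (_ : n ≤ L) :
      ‖∑ m ∈ Finset.range n, ((𝐞 (φ (m + 1)) : ℂ) - 𝐞 (φ m))‖ ≤ 2 := by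
    rw [Finset.sum_range_sub (fun m => (𝐞 (φ m) : ℂ))]
    refine (norm_sub_le _ _).trans ?_
    rw [Circle.norm_coe, Circle.norm_coe]
    norm_num
  calc _ = ‖∑ m ∈ Finset.range L,
        ((𝐞 (φ (m + 1)) : ℂ) - 𝐞 (φ m)) * ((𝐞 (Δ m) : ℂ) - 1)⁻¹‖ := by
        congr 1
        exact Finset.sum_congr rfl fun m hm => term_eq (Finset.mem_range_le hm)
    _ ≤ 2 * (1 / (4 * Δ L) +
          ∑ m ∈ Finset.range L, 1 / 2 * (1 / Δ m - 1 / Δ (m + 1))) := by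
        refine (norm_sum_mul_le_of_norm_sum_le telescoping).trans ?_
        gcongr with m hm
        · exact norm_inv_fourierChar_sub_one_le (Δ_pos le_rfl) hφL
        · have hm' : m + 1 ≤ L := Finset.mem_range.1 hm
          exact norm_inv_fourierChar_sub_one_sub_le (Δ_pos (by omega))
            (hφ (Set.mem_Iic.2 (by omega)) hm' m.le_succ) (Δ_le hm')
    _ = 1 / Δ 0 - 1 / (2 * Δ L) := by
        rw [← Finset.mul_sum, Finset.sum_range_sub' (fun m => 1 / Δ m)]
        have := (Δ_pos le_rfl).ne'
        field_simp
        ring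
    _ ≤ 1 / Δ 0 := sub_le_self _ (by have := Δ_pos le_rfl; positivity)

lemma norm_sum_fourierChar_le_add (f : ℕ → ℝ) (r t : ℕ) :
    ‖∑ m ∈ Finset.range t, (𝐞 (f m) : ℂ)‖ ≤
      r + ‖∑ m ∈ Finset.range (t - r), (𝐞 (f (r + m)) : ℂ)‖ := by
  rcases le_total t r with htr | hrt
  · rw [Nat.sub_eq_zero_of_le htr, Finset.sum_range_zero, norm_zero, add_zero]
    exact (norm_sum_fourierChar_le t f).trans (by exact_mod_cast htr)
  · conv_lhs => rw [← Nat.add_sub_of_le hrt, Finset.sum_range_add]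
    exact (norm_add_le _ _).trans (by gcongr; exact norm_sum_fourierChar_le r f)

lemma sum_range_sub_mean_of_periodic {w : ℕ → ℂ} {Q : ℕ} (hQ : 1 ≤ Q)
    (hw : Function.Periodic w Q) (n : ℕ) :
    ∑ m ∈ Finset.range n, (w m - (∑ j ∈ Finset.range Q, w j) / Q) =
      ∑ m ∈ Finset.range (n % Q), (w m - (∑ j ∈ Finset.range Q, w j) / Q) := by
  have sum_period : ∑ m ∈ Finset.range Q, (w m - (∑ j ∈ Finset.range Q, w j) / Q) = 0 := by
    have : (Q : ℂ) ≠ 0 := by exact_mod_cast (by omega : Q ≠ 0)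
    rw [Finset.sum_sub_distrib, Finset.sum_const, Finset.card_range, nsmul_eq_mul,
      mul_div_cancel₀ _ this, sub_self]
  induction n using Nat.strong_induction_on with
  | _ n ih =>
    rcases lt_or_ge n Q with hnQ | hQn
    · rw [Nat.mod_eq_of_lt hnQ]
    · obtain ⟨j, rfl⟩ := Nat.exists_eq_add_of_le hQn
      rw [Nat.add_mod_left, ← ih j (by omega), Finset.sum_range_add, sum_period, zero_add]
      simp only [add_comm Q, hw _]

lemma norm_sum_sub_mean_le_of_periodic {w : ℕ → ℂ} {Q : ℕ} (hQ : 1 ≤ Q)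
    (hw : Function.Periodic w Q) (hw' : ∀ n, ‖w n‖ ≤ 1) (n : ℕ) :
    ‖∑ m ∈ Finset.range n, (w m - (∑ j ∈ Finset.range Q, w j) / Q)‖ ≤ 2 * Q := by
  have norm_mean_le : ‖(∑ j ∈ Finset.range Q, w j) / Q‖ ≤ 1 := by
    rw [norm_div, Complex.norm_natCast]
    refine div_le_one_of_le₀ ((norm_sum_le_of_le _ fun m _ => hw' m).trans ?_) Q.cast_nonneg
    simp
  rw [sum_range_sub_mean_of_periodic hQ hw]
  calc _ ≤ ∑ _m ∈ Finset.range (n % Q), (1 + 1 : ℝ) :=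
        norm_sum_le_of_le _ fun m _ => (norm_sub_le _ _).trans (add_le_add (hw' m) norm_mean_le)
    _ = 2 * (n % Q : ℕ) := by
        rw [Finset.sum_const, Finset.card_range, nsmul_eq_mul]; ring
    _ ≤ 2 * Q := by gcongr; exact (Nat.mod_lt n hQ).le

lemma norm_sum_mul_sub_mean_mul_sum_le_of_periodic {w : ℕ → ℂ} {Q : ℕ} (hQ : 1 ≤ Q)
    (hw : Function.Periodic w Q) (hw' : ∀ n, ‖w n‖ ≤ 1) (u : ℕ → ℂ) (t : ℕ) :
    ‖∑ m ∈ Finset.range t, w m * u m -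
        (∑ j ∈ Finset.range Q, w j) / Q * ∑ m ∈ Finset.range t, u m‖ ≤
      2 * Q * (‖u t‖ + ∑ m ∈ Finset.range t, ‖u (m + 1) - u m‖) := by
  rw [Finset.mul_sum, ← Finset.sum_sub_distrib]
  simp only [← sub_mul]
  exact norm_sum_mul_le_of_norm_sum_le fun n _ => norm_sum_sub_mean_le_of_periodic hQ hw hw' n

lemma exists_abs_eval_le_mul_pow {p : ℝ[X]} {k : ℕ} (hp : p.natDegree ≤ k) :
    ∃ B : ℝ, 0 < B ∧ ∀ x : ℝ, 1 ≤ x → |p.eval x| ≤ B * x ^ k := by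
  refine ⟨∑ i ∈ Finset.range (k + 1), |p.coeff i| + 1, by positivity, fun x hx => ?_⟩
  have hx₀ : 0 ≤ x := zero_le_one.trans hx
  calc |p.eval x| = |∑ i ∈ Finset.range (k + 1), p.coeff i * x ^ i| := by
        rw [eval_eq_sum_range' (Nat.lt_succ_of_le hp)]
    _ ≤ ∑ i ∈ Finset.range (k + 1), |p.coeff i| * x ^ k := by
        refine (Finset.abs_sum_le_sum_abs _ _).trans (Finset.sum_le_sum fun i hi => ?_)
        rw [abs_mul, abs_of_nonneg (pow_nonneg hx₀ i)]
        gcongr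
        exact Finset.mem_range_succ_iff.1 hi
    _ = (∑ i ∈ Finset.range (k + 1), |p.coeff i|) * x ^ k := by rw [Finset.sum_mul]
    _ ≤ _ := by gcongr; exact le_add_of_nonneg_right zero_le_one

lemma eventually_eval_nonneg {p : ℝ[X]} (hp : 0 ≤ p.leadingCoeff) :
    ∀ᶠ x : ℝ in Filter.atTop, 0 ≤ p.eval x := by
  rcases p.natDegree.eq_zero_or_pos with degree_eq | degree_pos
  · rw [eq_C_of_natDegree_eq_zero degree_eq, leadingCoeff_C] at hp
    rw [eq_C_of_natDegree_eq_zero degree_eq]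
    simp only [eval_C, hp, Filter.eventually_true]
  · exact (p.tendsto_atTop_of_leadingCoeff_nonneg
      (natDegree_pos_iff_degree_pos.1 degree_pos) hp).eventually_ge_atTop 0

lemma eventually_leadingCoeff_mul_pow_le_eval {p : ℝ[X]} (hp : 0 < p.leadingCoeff) :
    ∀ᶠ x : ℝ in Filter.atTop, p.leadingCoeff / 2 * x ^ p.natDegree ≤ p.eval x := by
  set r := p - C (p.leadingCoeff / 2) * X ^ p.natDegree
  have coeff_r : r.coeff p.natDegree = p.leadingCoeff / 2 := by
    rw [coeff_sub, coeff_C_mul_X_pow, if_pos rfl, coeff_natDegree, sub_half]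
  have degree_r : r.natDegree = p.natDegree :=
    natDegree_eq_of_le_of_coeff_ne_zero
      ((natDegree_sub_le _ _).trans (max_le le_rfl (natDegree_C_mul_X_pow_le _ _)))
      (by rw [coeff_r]; positivity)
  have leadingCoeff_r : 0 ≤ r.leadingCoeff := by
    rw [leadingCoeff, degree_r, coeff_r]; positivity
  filter_upwards [eventually_eval_nonneg leadingCoeff_r] with x hx
  simpa only [r, eval_sub, eval_mul, eval_C, eval_pow, eval_X, sub_nonneg] using hx

lemma natDegree_taylor_one_sub {p : ℝ[X]} {k : ℕ} (hp : p.natDegree = k + 1) :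
    (taylor 1 p - p).natDegree = k := by
  refine natDegree_eq_of_le_of_coeff_ne_zero (natDegree_taylor_sub_le hp.le 1) ?_
  have leadingCoeff_ne : p.leadingCoeff ≠ 0 :=
    leadingCoeff_ne_zero.2 (ne_zero_of_natDegree_gt (n := k) (by omega))
  rw [coeff_taylor_sub hp.le, ← hp, coeff_natDegree, mul_one]
  exact mul_ne_zero (by positivity) leadingCoeff_ne

lemma leadingCoeff_taylor_one_sub {p : ℝ[X]} {k : ℕ} (hp : p.natDegree = k + 1) :
    (taylor 1 p - p).leadingCoeff = (k + 1) * p.leadingCoeff := by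
  rw [leadingCoeff, natDegree_taylor_one_sub hp, coeff_taylor_sub hp.le, mul_one, leadingCoeff, hp]

lemma eventually_eval_le_eval_add_one {p : ℝ[X]} (hp : 0 ≤ p.leadingCoeff) :
    ∀ᶠ x : ℝ in Filter.atTop, p.eval x ≤ p.eval (x + 1) := by
  rcases degree_eq : p.natDegree with _ | k
  · rw [eq_C_of_natDegree_eq_zero degree_eq]
    simp only [eval_C, le_refl, Filter.eventually_true]
  · have leadingCoeff_nonneg : 0 ≤ (taylor 1 p - p).leadingCoeff := by
      rw [leadingCoeff_taylor_one_sub degree_eq]; positivity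
    filter_upwards [eventually_eval_nonneg leadingCoeff_nonneg] with x hx
    rwa [eval_sub, taylor_eval, sub_nonneg] at hx

lemma exists_difference_bounds {p : ℝ[X]} {k : ℕ} (hp : p.natDegree = k + 1)
    (hlc : 0 < p.leadingCoeff) :
    ∃ c : ℝ, 0 < c ∧ ∃ x₀ : ℕ, ∀ x : ℝ, x₀ ≤ x →
      c * x ^ k ≤ (taylor 1 p - p).eval x ∧
        (taylor 1 p - p).eval x ≤ (taylor 1 p - p).eval (x + 1) := by
  have leadingCoeff_pos : 0 < (taylor 1 p - p).leadingCoeff := by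
    rw [leadingCoeff_taylor_one_sub hp]; positivity
  obtain ⟨x₀, hx₀⟩ := Filter.eventually_atTop.1 <|
    (eventually_leadingCoeff_mul_pow_le_eval leadingCoeff_pos).and
      (eventually_eval_le_eval_add_one leadingCoeff_pos.le)
  rw [natDegree_taylor_one_sub hp] at hx₀
  exact ⟨_, half_pos leadingCoeff_pos, ⌈x₀⌉₊, fun x hx => hx₀ x ((Nat.le_ceil x₀).trans hx)⟩

lemma exists_norm_sum_fourierChar_tail_le {p : ℝ[X]} {k : ℕ} (hp : p.natDegree = k + 1)
    (hlc : 0 < p.leadingCoeff) :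
    ∃ η : ℝ, 0 < η ∧ ∃ c : ℝ, 0 < c ∧ ∃ x₀ : ℕ, ∀ γ : ℝ, 0 < γ → ∀ r L : ℕ, x₀ ≤ r →
      γ * (r + L + 1 : ℝ) ^ k ≤ η →
        ‖∑ m ∈ Finset.range L, (𝐞 (γ * p.eval ((r + m : ℕ) + 1 : ℝ)) : ℂ)‖ ≤
          1 / (c * (γ * (r + 1 : ℝ) ^ k)) := by
  obtain ⟨c, hc, x₀, hx₀⟩ := exists_difference_bounds hp hlc
  obtain ⟨B, hB, upper⟩ := exists_abs_eval_le_mul_pow (natDegree_taylor_sub_le hp.le 1)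
  refine ⟨1 / (2 * B), by positivity, c, hc, x₀, fun γ hγ r L hr small => ?_⟩
  set φ : ℕ → ℝ := fun m => γ * p.eval ((r + m : ℕ) + 1 : ℝ)
  have difference_eq : ∀ m, φ (m + 1) - φ m = γ * (taylor 1 p - p).eval (r + m + 1 : ℝ) := by
    intro m
    simp only [φ, eval_sub, taylor_eval]
    push_cast
    ring_nf
  have large : ∀ m : ℕ, (x₀ : ℝ) ≤ r + m + 1 := fun m => by
    exact_mod_cast hr.trans (by omega : r ≤ r + m + 1)
  have lower : c * (γ * (r + 1 : ℝ) ^ k) ≤ φ 1 - φ 0 := by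
    rw [difference_eq 0, mul_left_comm]
    have := (hx₀ _ (large 0)).1
    rw [Nat.cast_zero, add_zero] at this ⊢
    gcongr
  have φ_pos : 0 < φ 1 - φ 0 := lt_of_lt_of_le (by positivity) lower
  refine (norm_sum_fourierChar_le_of_monotoneOn φ_pos (Monotone.monotoneOn ?_ _) ?_).trans
    (one_div_le_one_div_of_le (by positivity) lower)
  · refine monotone_nat_of_le_succ fun m => ?_
    simp only [difference_eq]
    have := (hx₀ _ (large m)).2
    push_cast
    rw [← add_assoc (r : ℝ)]
    gcongr
  · rw [difference_eq]
    calc γ * (taylor 1 p - p).eval (r + L + 1 : ℝ) ≤ γ * (B * (r + L + 1 : ℝ) ^ k) := by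
          gcongr
          exact (le_abs_self _).trans (upper _ (le_add_of_nonneg_left (by positivity)))
      _ = B * (γ * (r + L + 1 : ℝ) ^ k) := by ring
      _ ≤ B * (1 / (2 * B)) := by gcongr
      _ = 1 / 2 := by field_simp

lemma natCast_max_ceil_le {x : ℝ} (hx : 1 ≤ x) (m : ℕ) :
    ((max m ⌈x⌉₊ : ℕ) : ℝ) ≤ (m + 2) * x := by
  have ceil_lt := Nat.ceil_lt_add_one (zero_le_one.trans hx)
  rw [Nat.cast_max]
  exact max_le (by nlinarith) (by nlinarith)

lemma le_pow_succ_mul_pow {g x : ℝ} (hg : 0 < g) (hx : 1 / g ≤ x) (k : ℕ) :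
    g ≤ g ^ (k + 1) * x ^ k := by
  have one_le : 1 ≤ (g * x) ^ k := one_le_pow₀ ((div_le_iff₀' hg).1 hx)
  calc g ≤ g * (g * x) ^ k := le_mul_of_one_le_right hg.le one_le
    _ = g ^ (k + 1) * x ^ k := by ring

lemma exists_norm_sum_fourierChar_tail_le_one_div {p : ℝ[X]} {k : ℕ} (hp : p.natDegree = k + 1)
    (hlc : 0 < p.leadingCoeff) :
    ∃ η : ℝ, 0 < η ∧ ∃ C : ℝ, 0 < C ∧ ∃ x₀ : ℕ, ∀ (g : ℝ) (r t : ℕ), 0 < g → x₀ ≤ r →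
      1 / g ≤ r → g ^ (k + 1) * (t : ℝ) ^ k ≤ η →
      ‖∑ m ∈ Finset.range (t - r), (𝐞 (g ^ (k + 1) * p.eval ((r + m : ℕ) + 1 : ℝ)) : ℂ)‖ ≤
        C * (1 / g) := by
  obtain ⟨η, hη, c, hc, x₀, tail⟩ := exists_norm_sum_fourierChar_tail_le hp hlc
  refine ⟨η / 2 ^ k, by positivity, 1 / c, by positivity, x₀, fun g r t hg hr inv_le small => ?_⟩
  rcases le_or_gt t r with htr | htr
  · rw [Nat.sub_eq_zero_of_le htr, Finset.range_zero, Finset.sum_empty, norm_zero]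
    positivity
  have ht : (1 : ℝ) ≤ t := by exact_mod_cast (by omega : 1 ≤ t)
  have small' : g ^ (k + 1) * (r + (t - r : ℕ) + 1 : ℝ) ^ k ≤ η := by
    rw [Nat.cast_sub htr.le, add_sub_cancel]
    calc g ^ (k + 1) * (t + 1 : ℝ) ^ k ≤ g ^ (k + 1) * (2 * t : ℝ) ^ k := by gcongr; linarith
      _ = 2 ^ k * (g ^ (k + 1) * (t : ℝ) ^ k) := by ring
      _ ≤ 2 ^ k * (η / 2 ^ k) := by gcongr
      _ = η := by field_simp
  have derivative_ge : g ≤ g ^ (k + 1) * (r + 1 : ℝ) ^ k :=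
    le_pow_succ_mul_pow hg (inv_le.trans (by linarith)) k
  calc _ ≤ 1 / (c * (g ^ (k + 1) * (r + 1 : ℝ) ^ k)) := tail _ (by positivity) r _ hr small'
    _ ≤ 1 / (c * g) := by gcongr
    _ = 1 / c * (1 / g) := by rw [one_div_mul_one_div]

lemma exists_norm_weylMean_pow_le_one_div {p : ℝ[X]} {k : ℕ} (hp : p.natDegree = k + 1)
    (hlc : 0 < p.leadingCoeff) :
    ∃ η : ℝ, 0 < η ∧ ∃ C : ℝ, 0 < C ∧ ∀ (g : ℝ) (t : ℕ), 0 < g → 1 ≤ t →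
      g ^ (k + 1) * (t : ℝ) ^ k ≤ η → ‖weylMean p t (g ^ (k + 1))‖ ≤ C * (1 / (t * g)) := by
  obtain ⟨η, hη, C, hC, x₀, tail⟩ := exists_norm_sum_fourierChar_tail_le_one_div hp hlc
  refine ⟨min 1 η, by positivity, x₀ + 2 + C, by positivity, fun g t hg ht small => ?_⟩
  have ht' : (1 : ℝ) ≤ t := by exact_mod_cast ht
  have hg₁ : g ≤ 1 := by
    refine (pow_le_one_iff_of_nonneg hg.le k.succ_ne_zero).1 ?_
    exact (le_mul_of_one_le_right (by positivity) (one_le_pow₀ ht')).trans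
      (small.trans (min_le_left _ _))
  -- The first `1 / g` terms are estimated trivially; beyond them the phase grows at rate `g`.
  have tail_le := tail g (max x₀ ⌈1 / g⌉₊) t hg (le_max_left _ _)
    ((Nat.le_ceil _).trans (Nat.cast_le.2 (le_max_right _ _))) (small.trans (min_le_right _ _))
  have head_le := natCast_max_ceil_le ((one_le_div hg).2 hg₁) x₀
  have sum_le := norm_sum_fourierChar_le_add
    (fun m => g ^ (k + 1) * p.eval (m + 1 : ℝ)) (max x₀ ⌈1 / g⌉₊) t
  rw [norm_weylMean_eq, div_le_iff₀ (by positivity)]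
  calc _ ≤ (x₀ + 2) * (1 / g) + C * (1 / g) := sum_le.trans (add_le_add head_le tail_le)
    _ = (x₀ + 2 + C) * (1 / (t * g)) * t := by field_simp

lemma exists_norm_weylMean_sub_one_le {p : ℝ[X]} {d : ℕ} (hp : p.natDegree ≤ d) :
    ∃ C : ℝ, 0 < C ∧ ∀ (γ : ℝ) (t : ℕ), 1 ≤ t →
      ‖weylMean p t γ - 1‖ ≤ C * (|γ| * (t : ℝ) ^ d) := by
  obtain ⟨B, hB, growth⟩ := exists_abs_eval_le_mul_pow hp
  refine ⟨2 * Real.pi * B, by positivity, fun γ t ht => ?_⟩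
  have ht' : (t : ℂ) ≠ 0 := by exact_mod_cast (by omega : t ≠ 0)
  have sub_eq : weylMean p t γ - 1 =
      (∑ m ∈ Finset.range t, ((𝐞 (γ * p.eval (m + 1 : ℝ)) : ℂ) - 1)) / t := by
    rw [weylMean, Finset.sum_sub_distrib, Finset.sum_const, Finset.card_range, nsmul_one, sub_div,
      div_self ht']
  rw [sub_eq, norm_div, Complex.norm_natCast, div_le_iff₀ (by positivity)]
  calc _ ≤ ∑ m ∈ Finset.range t, 2 * Real.pi * B * (|γ| * (t : ℝ) ^ d) := by
        refine (norm_sum_le _ _).trans (Finset.sum_le_sum fun m hm => ?_)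
        have hm' : (m + 1 : ℝ) ≤ t := by exact_mod_cast Finset.mem_range.1 hm
        calc _ ≤ 2 * Real.pi * |γ * p.eval (m + 1 : ℝ)| := norm_fourierChar_sub_one_le _
          _ = 2 * Real.pi * (|γ| * |p.eval (m + 1 : ℝ)|) := by rw [abs_mul]
          _ ≤ 2 * Real.pi * (|γ| * (B * (m + 1 : ℝ) ^ d)) := by
              gcongr; exact growth _ (le_add_of_nonneg_left m.cast_nonneg)
          _ ≤ 2 * Real.pi * (|γ| * (B * (t : ℝ) ^ d)) := by gcongr
          _ = _ := by ring
    _ = _ := by rw [Finset.sum_const, Finset.card_range, nsmul_eq_mul, mul_comm]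

lemma le_max_mul_min {D A B y : ℝ} {k : ℕ} (hA : 0 ≤ A) (hy : 0 ≤ y) (hD : D ≤ A * y ^ (k + 1))
    (hD' : 0 < y → D ≤ B * (1 / y)) : D ≤ max A B * min y (1 / y) := by
  rcases le_or_gt y 1 with hy₁ | hy₁
  · have min_eq : min y (1 / y) = y := by
      rcases hy.eq_or_lt with rfl | hy₀
      · simp only [div_zero, min_self]
      · exact min_eq_left (hy₁.trans ((one_le_div hy₀).2 hy₁))
    rw [min_eq]
    calc D ≤ A * y ^ (k + 1) := hD
      _ ≤ max A B * y := by
        gcongr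
        exacts [le_max_left _ _, pow_le_of_le_one hy hy₁ k.succ_ne_zero]
  · have hy₀ := zero_lt_one.trans hy₁
    rw [min_eq_right (((div_le_one hy₀).2 hy₁.le).trans hy₁.le)]
    exact (hD' hy₀).trans (by gcongr; exact le_max_right _ _)

lemma weylMean_neg (p : ℝ[X]) (t : ℕ) (α : ℝ) :
    weylMean p t (-α) = starRingEnd ℂ (weylMean p t α) := by
  simp only [weylMean, map_div₀, map_sum, map_natCast, neg_mul, AddChar.map_neg_eq_inv,
    Circle.coe_inv_eq_conj]

lemma norm_weylMean_abs_sub (p : ℝ[X]) (t u : ℕ) (α : ℝ) :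
    ‖weylMean p t |α| - weylMean p u |α|‖ = ‖weylMean p t α - weylMean p u α‖ := by
  rcases abs_choice α with h | h <;> rw [h]
  rw [weylMean_neg, weylMean_neg, ← map_sub, Complex.norm_conj]

lemma exists_norm_weylMean_pow_sub_le_pow {p : ℝ[X]} {d : ℕ} (hp : p.natDegree ≤ d) :
    ∃ C : ℝ, 0 < C ∧ ∀ (g : ℝ) (N t : ℕ), 0 ≤ g → 1 ≤ N → N ≤ t → t ≤ 2 * N →
      ‖weylMean p t (g ^ d) - weylMean p N (g ^ d)‖ ≤ C * (N * g) ^ d := by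
  obtain ⟨C, hC, near_one⟩ := exists_norm_weylMean_sub_one_le hp
  refine ⟨C * (2 ^ d + 1), by positivity, fun g N t hg hN hNt htN => ?_⟩
  have htN' : (t : ℝ) ≤ 2 * N := by exact_mod_cast htN
  have near_one' := near_one (g ^ d)
  rw [abs_of_nonneg (by positivity)] at near_one'
  calc ‖weylMean p t (g ^ d) - weylMean p N (g ^ d)‖
      = ‖(weylMean p t (g ^ d) - 1) - (weylMean p N (g ^ d) - 1)‖ := by
        rw [sub_sub_sub_cancel_right]
    _ ≤ C * (g ^ d * (t : ℝ) ^ d) + C * (g ^ d * (N : ℝ) ^ d) :=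
        (norm_sub_le _ _).trans (add_le_add (near_one' t (hN.trans hNt)) (near_one' N hN))
    _ ≤ C * (g ^ d * (2 * N : ℝ) ^ d) + C * (g ^ d * (N : ℝ) ^ d) := by gcongr
    _ = C * (2 ^ d + 1) * (N * g) ^ d := by ring

lemma exists_norm_weylMean_pow_sub_le {p : ℝ[X]} {k : ℕ} (hp : p.natDegree = k + 1)
    (hlc : 0 < p.leadingCoeff) :
    ∃ C : ℝ, 0 < C ∧ ∀ (g : ℝ) (N t : ℕ), 0 ≤ g → 1 ≤ N → N ≤ t → t ≤ 2 * N →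
      ‖weylMean p t (g ^ (k + 1)) - weylMean p N (g ^ (k + 1))‖ ≤
        C * (min (N * g) (1 / (N * g)) + N ^ k * g ^ (k + 1)) := by
  obtain ⟨A, hA, small_frequency⟩ := exists_norm_weylMean_pow_sub_le_pow hp.le
  obtain ⟨η, hη, B, hB, decay⟩ := exists_norm_weylMean_pow_le_one_div hp hlc
  refine ⟨max (max A (2 * B)) (2 * 2 ^ k / η), by positivity, fun g N t hg hN hNt htN => ?_⟩
  have htN' : (t : ℝ) ≤ 2 * N := by exact_mod_cast htN
  have hNt' : (N : ℝ) ≤ t := by exact_mod_cast hNt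
  have min_nonneg : 0 ≤ min (N * g) (1 / (N * g)) := by positivity
  rcases le_or_gt (g ^ (k + 1) * (t : ℝ) ^ k) η with small | large
  · have min_bound := le_max_mul_min hA.le (y := N * g) (B := 2 * B) (by positivity)
      (small_frequency g N t hg hN hNt htN) fun hy => by
        have hg₀ : 0 < g := hg.lt_of_ne' (right_ne_zero_of_mul hy.ne')
        have small' : g ^ (k + 1) * (N : ℝ) ^ k ≤ η := le_trans (by gcongr) small
        calc _ ≤ B * (1 / (t * g)) + B * (1 / (N * g)) :=
              (norm_sub_le _ _).trans
                (add_le_add (decay g t hg₀ (hN.trans hNt) small) (decay g N hg₀ hN small'))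
          _ ≤ B * (1 / (N * g)) + B * (1 / (N * g)) := by gcongr
          _ = 2 * B * (1 / (N * g)) := by ring
    exact min_bound.trans <| mul_le_mul (le_max_left _ _)
      (le_add_of_nonneg_right (by positivity)) min_nonneg (by positivity)
  · calc _ ≤ (2 : ℝ) := (norm_sub_le _ _).trans
          ((add_le_add (norm_weylMean_le_one ..) (norm_weylMean_le_one ..)).trans
            one_add_one_eq_two.le)
      _ = 2 / η * η := by field_simp
      _ ≤ 2 / η * (g ^ (k + 1) * (2 * N : ℝ) ^ k) := by
          gcongr
          exact large.le.trans (by gcongr)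
      _ = 2 * 2 ^ k / η * (N ^ k * g ^ (k + 1)) := by ring
      _ ≤ _ := mul_le_mul (le_max_right _ _) (le_add_of_nonneg_left min_nonneg)
          (by positivity) (by positivity)

lemma exists_norm_weylMean_sub_le {p : ℝ[X]} {k : ℕ} (hp : p.natDegree = k + 1)
    (hlc : 0 < p.leadingCoeff) :
    ∃ C : ℝ, 0 < C ∧ ∀ (γ : ℝ) (N t : ℕ), 1 ≤ N → N ≤ t → t ≤ 2 * N →
      ‖weylMean p t γ - weylMean p N γ‖ ≤
        C * (min (N * |γ| ^ (1 / (p.natDegree : ℝ))) (1 / (N * |γ| ^ (1 / (p.natDegree : ℝ)))) +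
          N ^ k * |γ|) := by
  obtain ⟨C, hC, bound⟩ := exists_norm_weylMean_pow_sub_le hp hlc
  refine ⟨C, hC, fun γ N t hN hNt htN => ?_⟩
  have root_pow : (|γ| ^ (1 / (p.natDegree : ℝ))) ^ (k + 1) = |γ| := by
    rw [hp, one_div, Real.rpow_inv_natCast_pow (abs_nonneg γ) k.succ_ne_zero]
  have := bound (|γ| ^ (1 / (p.natDegree : ℝ))) N t (by positivity) hN hNt htN
  rwa [root_pow, norm_weylMean_abs_sub] at this

lemma periodic_fourierChar_eval (P : ℤ[X]) (A : ℤ) {Q : ℕ} (hQ : 1 ≤ Q) :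
    Function.Periodic
      (fun m : ℕ => (𝐞 (A / Q * (P.map (Int.castRingHom ℝ)).eval (m + 1 : ℝ)) : ℂ)) Q := by
  intro m
  obtain ⟨z, hz⟩ := sub_dvd_eval_sub ((m + Q : ℕ) + 1 : ℤ) (m + 1) P
  have eval_cast : ∀ i : ℕ,
      (P.map (Int.castRingHom ℝ)).eval (i + 1 : ℝ) = (P.eval (i + 1 : ℤ) : ℤ) := fun i => by
    have := eval_intCast_map (Int.castRingHom ℝ) P (i + 1)
    push_cast at this
    exact this
  have shift : (A / Q : ℝ) * (P.eval ((m + Q : ℕ) + 1 : ℤ) : ℤ) =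
      A / Q * (P.eval (m + 1 : ℤ) : ℤ) + (A * z : ℤ) := by
    rw [eq_add_of_sub_eq hz]
    push_cast
    field_simp
    ring
  simp only [eval_cast, shift, fourierChar_add_intCast]

lemma weylMean_mul_of_periodic {p : ℝ[X]} {Q : ℕ} {θ : ℝ} (hQ : 1 ≤ Q)
    (hθ : Function.Periodic (fun m : ℕ => (𝐞 (θ * p.eval (m + 1 : ℝ)) : ℂ)) Q) {j : ℕ}
    (hj : 1 ≤ j) : weylMean p (j * Q) θ = weylMean p Q θ := by
  have sum_sub_mean := sum_range_sub_mean_of_periodic hQ hθ (j * Q)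
  rw [Nat.mul_mod_left, Finset.range_zero, Finset.sum_empty, Finset.sum_sub_distrib,
    Finset.sum_const, Finset.card_range, nsmul_eq_mul, sub_eq_zero] at sum_sub_mean
  have hjQ : ((j * Q : ℕ) : ℂ) ≠ 0 := Nat.cast_ne_zero.2 (Nat.mul_pos hj hQ).ne'
  rw [weylMean, sum_sub_mean, mul_div_cancel_left₀ _ hjQ, weylMean]

lemma exists_sum_norm_fourierChar_sub_le {p : ℝ[X]} {k : ℕ} (hp : p.natDegree ≤ k + 1) :
    ∃ C : ℝ, 0 < C ∧ ∀ (γ : ℝ) (t : ℕ),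
      ∑ m ∈ Finset.range t, ‖(𝐞 (γ * p.eval ((m + 1 : ℕ) + 1 : ℝ)) : ℂ) -
        𝐞 (γ * p.eval (m + 1 : ℝ))‖ ≤ C * (|γ| * (t : ℝ) ^ (k + 1)) := by
  obtain ⟨B, hB, growth⟩ := exists_abs_eval_le_mul_pow (natDegree_taylor_sub_le hp 1)
  refine ⟨2 * Real.pi * B, by positivity, fun γ t => ?_⟩
  calc _ ≤ ∑ m ∈ Finset.range t, 2 * Real.pi * (|γ| * (B * (t : ℝ) ^ k)) := by
        refine Finset.sum_le_sum fun m hm => ?_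
        have hm' : (m + 1 : ℝ) ≤ t := by exact_mod_cast Finset.mem_range.1 hm
        have growth_m := growth (m + 1) (le_add_of_nonneg_left m.cast_nonneg)
        rw [eval_sub, taylor_eval] at growth_m
        refine (norm_fourierChar_sub_le _ _).trans ?_
        rw [← mul_sub, abs_mul, Nat.cast_succ]
        gcongr
        exact growth_m.trans (by gcongr)
    _ = _ := by rw [Finset.sum_const, Finset.card_range, nsmul_eq_mul]; ring

lemma exists_norm_weylMean_add_sub_mul_le {p : ℝ[X]} {k : ℕ} (hp : p.natDegree ≤ k + 1) :
    ∃ C : ℝ, 0 < C ∧ ∀ (θ γ : ℝ) (Q t : ℕ), 1 ≤ Q →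
      Function.Periodic (fun m : ℕ => (𝐞 (θ * p.eval (m + 1 : ℝ)) : ℂ)) Q →
      ‖weylMean p t (θ + γ) - weylMean p Q θ * weylMean p t γ‖ ≤
        C * (Q * (1 + |γ| * (t : ℝ) ^ (k + 1)) / t) := by
  obtain ⟨B, hB, variation⟩ := exists_sum_norm_fourierChar_sub_le hp
  refine ⟨2 * (1 + B), by positivity, fun θ γ Q t hQ hθ => ?_⟩
  set u : ℕ → ℂ := fun m => (𝐞 (γ * p.eval (m + 1 : ℝ)) : ℂ)
  have sub_eq : weylMean p t (θ + γ) - weylMean p Q θ * weylMean p t γ =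
      (∑ m ∈ Finset.range t, (𝐞 (θ * p.eval (m + 1 : ℝ)) : ℂ) * u m -
        weylMean p Q θ * ∑ m ∈ Finset.range t, u m) / t := by
    simp only [u, weylMean, add_mul, AddChar.map_add_eq_mul, Circle.coe_mul, sub_div, mul_div_assoc]
  have γt_nonneg : 0 ≤ |γ| * (t : ℝ) ^ (k + 1) := by positivity
  calc _ ≤ 2 * Q * (‖u t‖ + ∑ m ∈ Finset.range t, ‖u (m + 1) - u m‖) / t := by
        rw [sub_eq, norm_div, Complex.norm_natCast]
        gcongr
        exact norm_sum_mul_sub_mean_mul_sum_le_of_periodic hQ hθ (fun m => (Circle.norm_coe _).le)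
          u t
    _ ≤ 2 * Q * (1 + B * (|γ| * (t : ℝ) ^ (k + 1))) / t := by
        gcongr
        exacts [(Circle.norm_coe _).le, variation γ t]
    _ ≤ 2 * Q * ((1 + B) * (1 + |γ| * (t : ℝ) ^ (k + 1))) / t := by gcongr; nlinarith
    _ = _ := by ring

lemma exists_norm_weylMean_add_sub_mul_le_div {p : ℝ[X]} {k : ℕ} (hp : p.natDegree ≤ k + 1) :
    ∃ C : ℝ, 0 < C ∧ ∀ (θ γ V : ℝ) (Q N t : ℕ), 1 ≤ Q → 1 ≤ N → N ≤ t → t ≤ 2 * N → 1 ≤ V →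
      |γ| * (N : ℝ) ^ (k + 1) ≤ V →
      Function.Periodic (fun m : ℕ => (𝐞 (θ * p.eval (m + 1 : ℝ)) : ℂ)) Q →
      ‖weylMean p t (θ + γ) - weylMean p Q θ * weylMean p t γ‖ ≤ C * (Q * V / N) := by
  obtain ⟨A, hA, factorization⟩ := exists_norm_weylMean_add_sub_mul_le hp
  refine ⟨A * (1 + 2 ^ (k + 1)), by positivity, fun θ γ V Q N t hQ hN hNt htN hV hγ hθ => ?_⟩
  have htN' : (t : ℝ) ≤ 2 * N := by exact_mod_cast htN
  calc _ ≤ A * (Q * (1 + |γ| * (t : ℝ) ^ (k + 1)) / t) := factorization θ γ Q t hQ hθ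
    _ ≤ A * (Q * (V + |γ| * (2 * N : ℝ) ^ (k + 1)) / N) := by gcongr
    _ = A * (Q * (V + 2 ^ (k + 1) * (|γ| * (N : ℝ) ^ (k + 1))) / N) := by ring
    _ ≤ A * (Q * (V + 2 ^ (k + 1) * V) / N) := by gcongr
    _ = _ := by ring

lemma exists_norm_weylMean_add_sub_le {p : ℝ[X]} {k : ℕ} (hp : p.natDegree = k + 1)
    (hlc : 0 < p.leadingCoeff) :
    ∃ C : ℝ, 0 < C ∧ ∀ (θ γ V : ℝ) (Q N t : ℕ), 1 ≤ Q → 1 ≤ N → N ≤ t → t ≤ 2 * N → 1 ≤ V →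
      |γ| * (N : ℝ) ^ (k + 1) ≤ V →
      Function.Periodic (fun m : ℕ => (𝐞 (θ * p.eval (m + 1 : ℝ)) : ℂ)) Q →
      ‖weylMean p t (θ + γ) - weylMean p N (θ + γ)‖ ≤
        C * (‖weylMean p Q θ‖ * min (N * |γ| ^ (1 / (p.natDegree : ℝ)))
          (1 / (N * |γ| ^ (1 / (p.natDegree : ℝ)))) + Q * V / N) := by
  obtain ⟨A, hA, factorization⟩ := exists_norm_weylMean_add_sub_mul_le_div hp.le
  obtain ⟨B, hB, difference⟩ := exists_norm_weylMean_sub_le hp hlc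
  refine ⟨2 * A + B, by positivity,
    fun θ γ V Q N t hQ hN hNt htN hV hγ hθ => ?_⟩
  set G := weylMean p Q θ
  set μ := min (N * |γ| ^ (1 / (p.natDegree : ℝ))) (1 / (N * |γ| ^ (1 / (p.natDegree : ℝ))))
  have hN' : (0 : ℝ) < N := by exact_mod_cast hN
  have hQ' : (1 : ℝ) ≤ Q := by exact_mod_cast hQ
  have error_le : ∀ M : ℕ, N ≤ M → M ≤ 2 * N →
      ‖weylMean p M (θ + γ) - G * weylMean p M γ‖ ≤ A * (Q * V / N) :=
    fun M hNM hMN => factorization θ γ V Q N M hQ hN hNM hMN hV hγ hθ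
  have main_le : ‖G * (weylMean p t γ - weylMean p N γ)‖ ≤ B * (‖G‖ * μ + Q * V / N) := by
    have lower_order : ‖G‖ * (N ^ k * |γ|) ≤ Q * V / N := by
      rw [le_div_iff₀ hN']
      calc ‖G‖ * (N ^ k * |γ|) * N = ‖G‖ * (|γ| * (N : ℝ) ^ (k + 1)) := by ring
        _ ≤ Q * V := by gcongr; exact (norm_weylMean_le_one p Q θ).trans hQ'
    calc _ ≤ ‖G‖ * (B * (μ + N ^ k * |γ|)) := by
          rw [norm_mul]; gcongr; exact difference γ N t hN hNt htN
      _ = B * (‖G‖ * μ + ‖G‖ * (N ^ k * |γ|)) := by ring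
      _ ≤ _ := by gcongr
  have Gμ_nonneg : 0 ≤ 2 * A * (‖G‖ * μ) := by positivity
  calc _ = ‖(weylMean p t (θ + γ) - G * weylMean p t γ) -
        (weylMean p N (θ + γ) - G * weylMean p N γ) + G * (weylMean p t γ - weylMean p N γ)‖ := by
        ring_nf
    _ ≤ A * (Q * V / N) + A * (Q * V / N) +
        B * (‖G‖ * μ + Q * V / N) :=
      (norm_add_le _ _).trans (add_le_add ((norm_sub_le _ _).trans
        (add_le_add (error_le t hNt htN) (error_le N le_rfl (by omega)))) main_le)
    _ ≤ _ := by linarith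

lemma rpow_one_div_four_div {b q : ℕ} (hq : 1 ≤ q) :
    ((b * q * (b * q) : ℕ) : ℝ) ^ (1 / 4 : ℝ) / q =
      (b : ℝ) ^ (1 / 2 : ℝ) * (q : ℝ) ^ (-(1 / 2) : ℝ) := by
  have hq' : (0 : ℝ) < q := by exact_mod_cast hq
  calc ((b * q * (b * q) : ℕ) : ℝ) ^ (1 / 4 : ℝ) / q
      = ((b * q : ℝ) ^ (2 : ℝ)) ^ (1 / 4 : ℝ) / (q : ℝ) ^ (1 : ℝ) := by
        rw [Real.rpow_two, sq, Real.rpow_one]; push_cast; rfl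
    _ = (b : ℝ) ^ (1 / 2 : ℝ) * ((q : ℝ) ^ (1 / 2 : ℝ) / (q : ℝ) ^ (1 : ℝ)) := by
        rw [← Real.rpow_mul (by positivity), Real.mul_rpow (by positivity) hq'.le, mul_div_assoc]
        norm_num
    _ = _ := by rw [← Real.rpow_sub hq']; norm_num

lemma exists_norm_weylMean_rational_le {P : ℤ[X]} (hP : 1 ≤ P.natDegree) {b : ℕ} (hb : 1 ≤ b)
    (hbP : P.leadingCoeff = b) :
    ∃ ν : ℝ, 0 < ν ∧ ∃ C : ℝ, 0 < C ∧ ∀ (A : ℤ) (q : ℕ), 1 ≤ q → IsCoprime A (q : ℤ) →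
      ‖weylMean (P.map (Int.castRingHom ℝ)) (b * q) (A / (b * q : ℕ))‖ ≤ C * (q : ℝ) ^ (-ν) := by
  set p := P.map (Int.castRingHom ℝ)
  have degree_p : p.natDegree = P.natDegree :=
    natDegree_map_eq_of_injective (Int.castRingHom ℝ).injective_int P
  have leadingCoeff_p : p.leadingCoeff = b := by
    rw [leadingCoeff_map_of_injective (Int.castRingHom ℝ).injective_int, hbP]; simp
  obtain ⟨C, hC, weyl⟩ := exists_norm_weylMean_le (hP.trans degree_p.ge) (ε := 1 / 4) (by norm_num)
  set κ : ℝ := (2 ^ (p.natDegree - 1) : ℝ)⁻¹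
  refine ⟨1 / 2 * κ, by positivity, C * ((b : ℝ) ^ (1 / 2 : ℝ)) ^ κ, by positivity,
    fun A q hq coprime => ?_⟩
  have hQ : 1 ≤ b * q := Nat.mul_pos hb hq
  have hq' : (0 : ℝ) < q := by exact_mod_cast hq
  have hb' : (b : ℝ) ≠ 0 := by exact_mod_cast (by omega : b ≠ 0)
  have q_le : q ≤ b * q := Nat.le_mul_of_pos_left q hb
  have sq_le : (q * q : ℝ) ≤ ((b * q * (b * q) : ℕ) : ℝ) ^ p.natDegree := by
    exact_mod_cast (Nat.mul_le_mul q_le q_le).trans (Nat.le_self_pow (by omega) _)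
  rw [← weylMean_mul_of_periodic hQ (periodic_fourierChar_eval P A hQ) hQ]
  refine (weyl _ A q (b * q * (b * q)) q coprime ?_ hq' le_rfl
    (by exact_mod_cast q_le.trans (Nat.le_mul_of_pos_left _ hQ)) sq_le).trans_eq ?_
  · rw [leadingCoeff_p]
    have : (b : ℝ) * (A / (b * q : ℕ)) - A / q = 0 := by push_cast; field_simp; ring
    rw [this, abs_zero]
    positivity
  · rw [rpow_one_div_four_div hq, Real.mul_rpow (by positivity) (by positivity),
      ← Real.rpow_mul hq'.le, mul_assoc, neg_mul]

lemma exists_eq_arcDist (P : ℤ[X]) {a q : ℕ} (haq : a < q) (α : ℝ) :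
    ∃ z : ℤ, arcDist P a q α = |P.leadingCoeff * α - z - a / q| := by
  unfold arcDist
  split_ifs with hq
  · obtain rfl : a = 0 := by omega
    exact ⟨round (P.leadingCoeff * α : ℝ), by rw [Nat.cast_zero, zero_div, sub_zero]⟩
  · exact ⟨⌊(P.leadingCoeff * α : ℝ)⌋, rfl⟩

lemma exists_eq_div_add_of_coprime {P : ℤ[X]} {b : ℕ} (hb : 1 ≤ b) (hbP : P.leadingCoeff = b)
    {a q : ℕ} (haq : a < q) (coprime : a.Coprime q) (α : ℝ) :
    ∃ A : ℤ, IsCoprime A (q : ℤ) ∧ ∃ γ : ℝ, α = A / (b * q : ℕ) + γ ∧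
      arcDist P a q α = b * |γ| := by
  obtain ⟨z, dist_eq⟩ := exists_eq_arcDist P haq α
  have hb' : (0 : ℝ) < b := by exact_mod_cast hb
  have hq' : (0 : ℝ) < q := by exact_mod_cast haq.pos
  refine ⟨a + z * q, IsCoprime.add_mul_right_left_iff.2 (Nat.isCoprime_iff_coprime.2 coprime),
    (P.leadingCoeff * α - z - a / q) / b, ?_, ?_⟩
  · rw [hbP]; push_cast; field_simp; ring
  · rw [dist_eq, abs_div, abs_of_pos hb', mul_div_cancel₀ _ hb'.ne']

lemma min_one_div_le_mul_min {x y b : ℝ} (hb : 1 ≤ b) (hx : 0 ≤ x) (hxy : x ≤ y) (hyx : y ≤ b * x) :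
    min x (1 / x) ≤ b * min y (1 / y) := by
  rcases hx.eq_or_lt with rfl | hx₀
  · obtain rfl : y = 0 := le_antisymm (by simpa using hyx) hxy
    simp only [div_zero, min_self, mul_zero, le_refl]
  · have hy₀ : 0 < y := hx₀.trans_le hxy
    rw [mul_min_of_nonneg _ _ (by positivity)]
    refine min_le_min (hxy.trans (le_mul_of_one_le_left hy₀.le hb)) ?_
    rw [mul_one_div, div_le_div_iff₀ hx₀ hy₀]
    linarith

lemma min_rpow_le_mul_min {N b x r : ℝ} (hN : 0 ≤ N) (hb : 1 ≤ b) (hx : 0 ≤ x) (hr : 0 ≤ r)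
    (hr' : r ≤ 1) :
    min (N * x ^ r) (1 / (N * x ^ r)) ≤ b * min (N * (b * x) ^ r) (1 / (N * (b * x) ^ r)) := by
  refine min_one_div_le_mul_min hb (by positivity) ?_ ?_
  · gcongr
    exact le_mul_of_one_le_left hx hb
  · calc N * (b * x) ^ r = N * (b ^ r * x ^ r) := by
          rw [Real.mul_rpow (by positivity) hx]
      _ ≤ N * (b ^ (1 : ℝ) * x ^ r) := by gcongr
      _ = b * (N * x ^ r) := by rw [Real.rpow_one]; ring

lemma mul_two_pow_pow_le_of_le {n d : ℕ} {δ x : ℝ} (hx : x ≤ (2 : ℝ) ^ (-(n * (d - δ) : ℝ))) :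
    x * ((2 ^ n : ℕ) : ℝ) ^ d ≤ (2 : ℝ) ^ (n * δ : ℝ) := by
  have cast_eq : ((2 ^ n : ℕ) : ℝ) ^ d = (2 : ℝ) ^ (n * d : ℝ) := by
    rw [Nat.cast_pow, Nat.cast_two, ← pow_mul, ← Nat.cast_mul, Real.rpow_natCast]
  calc _ ≤ (2 : ℝ) ^ (-(n * (d - δ) : ℝ)) * (2 : ℝ) ^ (n * d : ℝ) := by rw [cast_eq]; gcongr
    _ = (2 : ℝ) ^ (n * δ : ℝ) := by rw [← Real.rpow_add two_pos]; ring_nf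

lemma rpow_neg_le_of_two_pow_le {s q : ℕ} (hq : 2 ^ s ≤ q) {μ ν : ℝ} (hν : 0 ≤ ν) (hμ : μ ≤ ν) :
    (q : ℝ) ^ (-ν) ≤ (2 : ℝ) ^ (-(μ * s)) := by
  have hq' : (2 : ℝ) ^ (s : ℝ) ≤ q := by rw [Real.rpow_natCast]; exact_mod_cast hq
  calc (q : ℝ) ^ (-ν) ≤ ((2 : ℝ) ^ (s : ℝ)) ^ (-ν) :=
        Real.rpow_le_rpow_of_nonpos (by positivity) hq' (neg_nonpos.2 hν)
    _ = (2 : ℝ) ^ (-(ν * s)) := by rw [← Real.rpow_mul two_pos.le]; ring_nf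
    _ ≤ (2 : ℝ) ^ (-(μ * s)) := by gcongr; exact one_le_two

lemma two_rpow_sq_div_two_pow_le {n s : ℕ} {δ ν : ℝ} (hs : s ≤ n * δ) (hν : 0 ≤ ν)
    (hνδ : ν * δ ≤ 1 / 2 - 2 * δ) :
    (2 : ℝ) ^ (n * δ : ℝ) * (2 : ℝ) ^ (n * δ : ℝ) / (2 ^ n : ℕ) ≤
      (2 : ℝ) ^ (-(ν * s)) * (2 : ℝ) ^ (-((n : ℝ) / 2)) := by
  rw [Nat.cast_pow, Nat.cast_two, ← Real.rpow_natCast 2 n, ← Real.rpow_add two_pos,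
    ← Real.rpow_sub two_pos, ← Real.rpow_add two_pos]
  refine Real.rpow_le_rpow_of_exponent_le one_le_two ?_
  have νs_le : ν * s ≤ n * (1 / 2 - 2 * δ) := by
    calc ν * s ≤ ν * (n * δ) := by gcongr
      _ = n * (ν * δ) := by ring
      _ ≤ _ := by gcongr
  linarith

lemma arcDist_nonneg (P : ℤ[X]) (a q : ℕ) (α : ℝ) : 0 ≤ arcDist P a q α := by
  unfold arcDist
  split_ifs <;> exact abs_nonneg _

lemma mul_two_rpow_div_two_pow_le {q n s : ℕ} {δ ν : ℝ} (hq : q ≤ 2 ^ (s + 1))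
    (hs : s ≤ n * δ) (hν : 0 ≤ ν) (hνδ : ν * δ ≤ 1 / 2 - 2 * δ) :
    q * (2 : ℝ) ^ (n * δ : ℝ) / (2 ^ n : ℕ) ≤
      2 * ((2 : ℝ) ^ (-(ν * s)) * (2 : ℝ) ^ (-((n : ℝ) / 2))) := by
  have q_le : (q : ℝ) ≤ 2 * (2 : ℝ) ^ (n * δ : ℝ) := by
    calc (q : ℝ) ≤ 2 * (2 : ℝ) ^ (s : ℝ) := by
          rw [Real.rpow_natCast, ← pow_succ']; exact_mod_cast hq
      _ ≤ _ := by gcongr; exact one_le_two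
  calc _ ≤ 2 * (2 : ℝ) ^ (n * δ : ℝ) * (2 : ℝ) ^ (n * δ : ℝ) / (2 ^ n : ℕ) := by gcongr
    _ = 2 * ((2 : ℝ) ^ (n * δ : ℝ) * (2 : ℝ) ^ (n * δ : ℝ) / (2 ^ n : ℕ)) := by ring
    _ ≤ _ := by gcongr; exact two_rpow_sq_div_two_pow_le hs hν hνδ

lemma exists_norm_weylMean_div_add_sub_le {P : ℤ[X]} (hd : 1 ≤ P.natDegree) {b : ℕ} (hb : 1 ≤ b)
    (hbP : P.leadingCoeff = b) :
    ∃ κ : ℝ, 0 < κ ∧ ∃ C : ℝ, 0 < C ∧ ∀ (A : ℤ) (γ V : ℝ) (q N t : ℕ), 1 ≤ q →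
      IsCoprime A (q : ℤ) → 1 ≤ N → N ≤ t → t ≤ 2 * N → 1 ≤ V → |γ| * (N : ℝ) ^ P.natDegree ≤ V →
      ‖weylMean (P.map (Int.castRingHom ℝ)) t (A / (b * q : ℕ) + γ) -
          weylMean (P.map (Int.castRingHom ℝ)) N (A / (b * q : ℕ) + γ)‖ ≤
        C * ((q : ℝ) ^ (-κ) * min (N * |γ| ^ (1 / (P.natDegree : ℝ)))
          (1 / (N * |γ| ^ (1 / (P.natDegree : ℝ)))) + q * V / N) := by
  have degree_map := natDegree_map_eq_of_injective (Int.castRingHom ℝ).injective_int P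
  obtain ⟨k, degree_eq⟩ : ∃ k, P.natDegree = k + 1 := Nat.exists_eq_add_of_le' hd
  have leadingCoeff_pos : 0 < (P.map (Int.castRingHom ℝ)).leadingCoeff := by
    rw [leadingCoeff_map_of_injective (Int.castRingHom ℝ).injective_int, hbP]
    simpa using Nat.pos_of_ne_zero (by omega)
  obtain ⟨κ, hκ, G, hG, gauss⟩ := exists_norm_weylMean_rational_le hd hb hbP
  obtain ⟨B, hB, major⟩ :=
    exists_norm_weylMean_add_sub_le (degree_map.trans degree_eq) leadingCoeff_pos
  rw [degree_map] at major
  refine ⟨κ, hκ, B * (G + b), by positivity,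
    fun A γ V q N t hq coprime hN hNt htN hV hγ => ?_⟩
  set μ := min (N * |γ| ^ (1 / (P.natDegree : ℝ))) (1 / (N * |γ| ^ (1 / (P.natDegree : ℝ))))
  have hQ : 1 ≤ b * q := Nat.mul_pos hb hq
  calc _ ≤ B * (‖weylMean (P.map (Int.castRingHom ℝ)) (b * q) (A / (b * q : ℕ))‖ * μ +
          (b * q : ℕ) * V / N) :=
        major _ γ V (b * q) N t hQ hN hNt htN hV (degree_eq ▸ hγ)
          (periodic_fourierChar_eval P A hQ)
    _ ≤ B * (G * (q : ℝ) ^ (-κ) * μ + (b * q : ℕ) * V / N) := by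
        gcongr; exact gauss A q hq coprime
    _ = B * (G * ((q : ℝ) ^ (-κ) * μ) + b * (q * V / N)) := by push_cast; ring
    _ ≤ B * ((G + b) * ((q : ℝ) ^ (-κ) * μ) + (G + b) * (q * V / N)) := by
        gcongr <;> linarith [hG, (Nat.cast_nonneg b : (0 : ℝ) ≤ b)]
    _ = _ := by ring

lemma exists_norm_weylMean_sub_le_of_mem_majorArc {P : ℤ[X]} (hd : 1 ≤ P.natDegree)
    (hP : 0 < P.leadingCoeff) {δ : ℝ} (hδ : 0 < δ) (hδ' : δ < 1 / 4) :
    ∃ ν : ℝ, 0 < ν ∧ ∃ C : ℝ, 0 < C ∧ ∀ n t : ℕ, 2 ^ n ≤ t → t ≤ 2 ^ (n + 1) →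
      ∀ s a q : ℕ, s ≤ n * δ → (a, q) ∈ ratShell s → ∀ α ∈ majorArc P δ n a q,
        ‖weylMean (P.map (Int.castRingHom ℝ)) t α -
            weylMean (P.map (Int.castRingHom ℝ)) (2 ^ n) α‖ ≤
          C * (2 : ℝ) ^ (-(ν * s)) *
            (min ((2 : ℝ) ^ (n : ℝ) * arcDist P a q α ^ (1 / (P.natDegree : ℝ)))
              (1 / ((2 : ℝ) ^ (n : ℝ) * arcDist P a q α ^ (1 / (P.natDegree : ℝ)))) +
            (2 : ℝ) ^ (-((n : ℝ) / 2))) := by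
  obtain ⟨b, hbP⟩ := Int.eq_ofNat_of_zero_le hP.le
  have hb : 1 ≤ b := by omega
  have hb' : (1 : ℝ) ≤ b := by exact_mod_cast hb
  obtain ⟨κ, hκ, B, hB, major⟩ := exists_norm_weylMean_div_add_sub_le hd hb hbP
  have hν : 0 < min κ ((1 / 2 - 2 * δ) / δ) := lt_min hκ (div_pos (by linarith) hδ)
  have hνκ : min κ ((1 / 2 - 2 * δ) / δ) ≤ κ := min_le_left _ _
  have hνδ : min κ ((1 / 2 - 2 * δ) / δ) * δ ≤ 1 / 2 - 2 * δ :=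
    (le_div_iff₀ hδ).1 (min_le_right _ _)
  set ν := min κ ((1 / 2 - 2 * δ) / δ)
  refine ⟨ν, hν, B * (b + 2), by positivity, ?_⟩
  rintro n t htn htn' s a q hs ⟨haq, coprime, hq, hq'⟩ α hα
  obtain ⟨A, coprime_A, γ, rfl, dist_eq⟩ := exists_eq_div_add_of_coprime hb hbP haq coprime α
  have dist_lt : arcDist P a q _ < _ := hα
  rw [dist_eq] at dist_lt ⊢
  set μ := min ((2 : ℝ) ^ (n : ℝ) * (b * |γ|) ^ (1 / (P.natDegree : ℝ)))
    (1 / ((2 : ℝ) ^ (n : ℝ) * (b * |γ|) ^ (1 / (P.natDegree : ℝ))))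
  have hγ := mul_two_pow_pow_le_of_le ((le_mul_of_one_le_left (abs_nonneg γ) hb').trans dist_lt.le)
  have hV : 1 ≤ (2 : ℝ) ^ (n * δ : ℝ) := Real.one_le_rpow one_le_two (by positivity)
  calc _ ≤ _ := major A γ _ q (2 ^ n) t haq.pos coprime_A Nat.one_le_two_pow htn
        (by rwa [← pow_succ']) hV hγ
    _ ≤ B * ((2 : ℝ) ^ (-(ν * s)) * (b * μ) +
          2 * ((2 : ℝ) ^ (-(ν * s)) * (2 : ℝ) ^ (-((n : ℝ) / 2)))) := by
        gcongr
        · exact rpow_neg_le_of_two_pow_le hq hκ.le hνκ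
        · rw [Nat.cast_pow, Nat.cast_two, ← Real.rpow_natCast]
          exact min_rpow_le_mul_min (by positivity) hb' (abs_nonneg γ) (by positivity)
            (div_le_one_of_le₀ (by exact_mod_cast hd) (by positivity))
        · exact mul_two_rpow_div_two_pow_le hq'.le hs hν.le hνδ
    _ ≤ B * ((2 : ℝ) ^ (-(ν * s)) * ((b + 2) * μ) +
          (b + 2) * ((2 : ℝ) ^ (-(ν * s)) * (2 : ℝ) ^ (-((n : ℝ) / 2)))) := by
        gcongr <;> linarith
    _ = _ := by ring

end PolyMeans

theorem mainTheorem6 :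
    ∃ A : ℝ, 0 < A ∧
      ∀ P : ℤ[X], 1 ≤ P.natDegree → 0 < P.leadingCoeff →
      ∀ δ : ℝ, 0 < δ → δ < 1 / 4 →
      ∃ ν : ℝ, 0 < ν ∧ ∃ C : ℝ, 0 < C ∧
      ∀ n t : ℕ, 2 ^ n ≤ t → t ≤ 2 ^ (n + 1) →
        (∀ α : ℝ,
          PolyMeans.fourierZ (PolyMeans.kernelC P n t - PolyMeans.kernelC P n (t + 1)) α =
            PolyMeans.fourierZ (PolyMeans.kernelK P t - PolyMeans.kernelK P (t + 1)) α ∧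
          ‖PolyMeans.fourierZ (PolyMeans.kernelK P t - PolyMeans.kernelK P (t + 1)) α‖
            ≤ A * (2 : ℝ) ^ (-(n : ℝ))) ∧
        (∀ α ∈ PolyMeans.minorArcs P δ n,
          ‖PolyMeans.fourierZ (PolyMeans.kernelC P n t) α‖ ≤ C * (2 : ℝ) ^ (-((n : ℝ) * ν))) ∧
        (∀ s a q : ℕ, (s : ℝ) ≤ (n : ℝ) * δ → (a, q) ∈ PolyMeans.ratShell s →
          ∀ α ∈ PolyMeans.majorArc P δ n a q,
            ‖PolyMeans.fourierZ (PolyMeans.kernelC P n t) α‖ ≤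
              C * (2 : ℝ) ^ (-(ν * (s : ℝ))) *
                (min ((2 : ℝ) ^ (n : ℝ) *
                        PolyMeans.arcDist P a q α ^ (1 / (P.natDegree : ℝ)))
                    (1 / ((2 : ℝ) ^ (n : ℝ) *
                        PolyMeans.arcDist P a q α ^ (1 / (P.natDegree : ℝ)))) +
                  (2 : ℝ) ^ (-((n : ℝ) / 2)))) := by
  refine ⟨2, two_pos, fun P hd hP δ hδ hδ' => ?_⟩
  obtain ⟨ν₁, hν₁, C₁, hC₁, minor⟩ :=
    PolyMeans.exists_norm_weylMean_le_of_mem_minorArcs hd hδ (by linarith)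
  obtain ⟨ν₂, hν₂, C₂, _, major⟩ :=
    PolyMeans.exists_norm_weylMean_sub_le_of_mem_majorArc hd hP hδ hδ'
  refine ⟨min ν₁ ν₂, lt_min hν₁ hν₂, max (2 * C₁) C₂, by positivity, fun n t htn htn' =>
    ⟨fun α => ⟨PolyMeans.fourierZ_kernelC_sub_kernelC P n t (t + 1) α, ?_⟩, fun α hα => ?_,
      fun s a q hs hr α hα => ?_⟩⟩
  · rw [PolyMeans.norm_fourierZ_kernelK_sub]
    exact PolyMeans.norm_weylMean_two_pow_sub_le _ htn α
  · rw [PolyMeans.kernelC, PolyMeans.norm_fourierZ_kernelK_sub]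
    calc _ ≤ C₁ * (2 : ℝ) ^ (-(n * ν₁)) + C₁ * (2 : ℝ) ^ (-(n * ν₁)) :=
          (norm_sub_le _ _).trans (add_le_add (minor n t htn htn' α hα)
            (minor n (2 ^ n) le_rfl (Nat.pow_le_pow_right two_pos n.le_succ) α hα))
      _ = 2 * C₁ * (2 : ℝ) ^ (-(n * ν₁)) := by ring
      _ ≤ _ := by gcongr; exacts [le_max_left _ _, one_le_two, min_le_left _ _]
  · rw [PolyMeans.kernelC, PolyMeans.norm_fourierZ_kernelK_sub]
    refine (major n t htn htn' s a q hs hr α hα).trans ?_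
    have dist_nonneg := PolyMeans.arcDist_nonneg P a q α
    gcongr
    exacts [le_max_right _ _, one_le_two, min_le_right _ _]
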